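/- **Setting.** Let $k$ be a perfect field, $\bar k$ an algebraic closure, $G_F=\mathrm{Gal}(\bar k/F)$ for $k\subseteq F\subseteq\bar k$. Let $c,d\in k^*$ with $d$ not a square in $k$ (this holds in particular whenever the quaternion algebra $(c,d)$ is not split), put $l=k(\sqrt d)$, and let $\sigma\in G_k$ restrict to the nontrivial element of $\mathrm{Gal}(l/k)$. Let $E=k(x,y)$ with $1=cx^2+dy^2$ and $u=(1+\sqrt d\,y)/x$, so that $El=l(u)$. Let $s$ be the automorphism of $\bar k(u)$ which acts as $\sigma$ on $\bar k$ and fixes $x$ and $y$; thus $s(u)=c/u$. All cohomology is continuous cohomology with discrete coefficients, written additively. Write $\mathrm X(F)=H^1(G_F,\mathbb Q/\mathbb Z)$, $\mathrm{Br}(l)=H^2(G_l,\bar k^*)$ and $\mathrm{Br}(l(u))=H^2(G_l,\bar k(u)^*)$, where $G_l$ acts on the coefficients and fixes $u$. Let $s^*$ be the endomorphism of $\mathrm{Br}(l(u))$ given on $2$-cocycles by $h\mapsto\big((g_1,g_2)\mapsto s(h(\sigma^{-1}g_1\sigma,\sigma^{-1}g_2\sigma))\big)$. For $\gamma\in G_k$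 normalizing $G_F$ let $(\gamma\chi)(g)=\chi(\gamma^{-1}g\gamma)$ for $\chi\in\mathrm X(F)$, and let $\sigma$ act on $\mathrm{Br}(l)$ by $(\sigma h)(g_1,g_2)=\sigma(h(\sigma^{-1}g_1\sigma,\sigma^{-1}g_2\sigma))$. Let $p$ range over the monic irreducible polynomials in $l[u]$ other than $u$. For each $p$ fix a root $a_p\in\bar k^*$, and let $\tilde p$ be the monic irreducible polynomial over $l$ whose roots are the $c/\sigma(a)$ with $p(a)=0$. Let $\mathrm{Cor}=\mathrm{Cor}_{l(a_p)/l}:\mathrm X(l(a_p))\to\mathrm X(l)$ be corestriction, and write $\mathrm{Cor}$ also for the sum of these maps on $\bigoplus_p\mathrm X(l(a_p))$. The Auslander–Brumer–Faddeev decomposition is the isomorphism $$\mathrm{Br}(l)\oplus\mathrm X(l)\oplus\bigoplus_p\mathrm X(l(a_p))\;\cong\;\mathrm{Br}(l(u))$$ given on $\mathrm{Br}(l)$ by the inclusion $\bar k^*\subset\bar k(u)^*$; on $\mathrm X(l)$ by the connecting map $\delta:\mathrm X(l)\to H^2(G_l,\mathbb Z)$ followed by the map induced by $e\mapsto u^e$;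 and on $\mathrm X(l(a_p))$ by $\delta:\mathrm X(l(a_p))\to H^2(G_{l(a_p)},\mathbb Z)$, followed by the Shapiro isomorphism onto $H^2(G_l,A)$ with $A=\mathrm{Hom}_{G_{l(a_p)}}(G_l,\mathbb Z)$ (the inverse of the map induced by $G_{l(a_p)}\subseteq G_l$ and $x\mapsto x(1)$), followed by the map induced by $\iota:A\to\bar k(u)^*$, $\iota(x)=\prod_{\tau G_{l(a_p)}\in G_l/G_{l(a_p)}}(u-\tau(a_p))^{x(\tau^{-1})}$. With respect to this decomposition let $s^*_{pq}:\mathrm X(l(a_p))\to\mathrm X(l(a_q))$, $s^*_{u1}:\mathrm X(l)\to\mathrm{Br}(l)$ and $s^*_{p1}:\mathrm X(l(a_p))\to\mathrm{Br}(l)$ be the components of $s^*$, and let $s_1^*=s^*_{u1}+\sum_p s^*_{p1}$ on $\mathrm X(l)\oplus\bigoplus_p\mathrm X(l(a_p))$. **Proposition.** There is exactly one isomorphism as just described, and the following hold. 1. For all $p$ and all $\chi_p\in\mathrm X(l(a_p))$, $$\mathrm{Cor}_{l(a_{\tilde p})/l}(s^*_{p\tilde p}(\chi_p))=\sigma(\mathrm{Cor}_{l(a_p)/l}(\chi_p)).$$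 2. If $p=\tilde p$, then there is $\tau\in G_l$ with $\sigma\tau(a_p)=c/a_p$; and for every such $\tau$ the element $\tilde\sigma=\sigma\tau$ satisfies $\tilde\sigma^{-1}G_{l(a_p)}\tilde\sigma\subseteq G_{l(a_p)}$ and $s^*_{pp}(\chi_p)=\tilde\sigma(\chi_p)$ for all $\chi_p\in\mathrm X(l(a_p))$. 3. Let $\sum\chi_p\in\bigoplus_p\mathrm X(l(a_p))$ satisfy $s^*_{p\tilde p}(\chi_p)=\chi_{\tilde p}$ for all $p$. Then $$\sigma\Big(\mathrm{Cor}\sum\chi_p\Big)=\mathrm{Cor}\sum\chi_p .$$ If in addition $\chi_u\in\mathrm X(l)$ satisfies $(1+\sigma)\chi_u=-\mathrm{Cor}\sum\chi_p$, then $$\sigma\Big(s_1^*\big(\chi_u+\sum\chi_p\big)\Big)=-s_1^*\big(\chi_u+\sum\chi_p\big).$$ -/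

import Mathlib

open scoped Polynomial

namespace GenusZero

noncomputable section

/-! ## Continuous cochain cohomology with discrete coefficients

For a topological group `G` acting on a discrete module `M`, a cochain is continuous exactly when
it is locally constant. -/

section Cohomology

variable {G G' M M' : Type*} [Group G] [TopologicalSpace G] [Group G'] [TopologicalSpace G']
  [AddCommGroup M] [AddCommGroup M']

/-- The coboundary `(d b)(g₁, g₂) = g₁ b(g₂) - b(g₁ g₂) + b(g₁)` of a `1`-cochain. -/
def d1 (ρ : G →* AddMonoid.End M) : (G → M) →+ (G × G → M) where
  toFun b := fun g => ρ g.1 (b g.2) - b (g.1 * g.2) + b g.1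
  map_zero' := by ext; simp
  map_add' b b' := by ext; simp; abel

/-- Continuous `1`-cochains. -/
def C1 (G M : Type*) [TopologicalSpace G] [AddCommGroup M] : AddSubgroup (G → M) where
  carrier := {b | IsLocallyConstant b}
  zero_mem' := IsLocallyConstant.const 0
  add_mem' hf hg := hf.add hg
  neg_mem' hf := hf.neg

/-- Continuous inhomogeneous `2`-cocycles. -/
def Z2 (ρ : G →* AddMonoid.End M) : AddSubgroup (G × G → M) where
  carrier := {f | IsLocallyConstant f ∧ ∀ g₁ g₂ g₃ : G,
    ρ g₁ (f (g₂, g₃)) - f (g₁ * g₂, g₃) + f (g₁, g₂ * g₃) - f (g₁, g₂) = 0}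
  zero_mem' := ⟨IsLocallyConstant.const 0, by simp⟩
  add_mem' {f f'} hf hf' := ⟨hf.1.add hf'.1, fun g₁ g₂ g₃ => by
    have h := congrArg₂ (· + ·) (hf.2 g₁ g₂ g₃) (hf'.2 g₁ g₂ g₃)
    simp only [add_zero] at h
    rw [← h]; simp only [Pi.add_apply, map_add]; abel⟩
  neg_mem' {f} hf := ⟨hf.1.neg, fun g₁ g₂ g₃ => by
    have h := congrArg Neg.neg (hf.2 g₁ g₂ g₃)
    simp only [neg_zero] at h
    rw [← h]; simp only [Pi.neg_apply, map_neg]; abel⟩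

/-- Coboundaries of continuous `1`-cochains. -/
def B2 (ρ : G →* AddMonoid.End M) : AddSubgroup (G × G → M) := (C1 G M).map (d1 ρ)

/-- The continuous cohomology group `H²(G, M)`. -/
def H2 (ρ : G →* AddMonoid.End M) : Type _ := Z2 ρ ⧸ (B2 ρ).addSubgroupOf (Z2 ρ)

instance (ρ : G →* AddMonoid.End M) : AddCommGroup (H2 ρ) :=
  inferInstanceAs (AddCommGroup (Z2 ρ ⧸ (B2 ρ).addSubgroupOf (Z2 ρ)))

/-- The class of a `2`-cocycle. -/
def H2.mk (ρ : G →* AddMonoid.End M) : Z2 ρ →+ H2 ρ := QuotientAddGroup.mk' _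

/-- The homomorphism on `2`-cocycles induced by a compatible pair `φ : G' → G`, `ψ : M → M'`:
`f ↦ ψ (f (φ g₁, φ g₂))`. -/
def Z2.map {ρ : G →* AddMonoid.End M} {ρ' : G' →* AddMonoid.End M'} (φ : G' →* G)
    (hφ : Continuous φ) (ψ : M →+ M') (h : ∀ g m, ψ (ρ (φ g) m) = ρ' g (ψ m)) :
    Z2 ρ →+ Z2 ρ' where
  toFun f := ⟨fun g => ψ (f.1 (φ g.1, φ g.2)),
    (f.2.1.comp_continuous (f := fun g : G' × G' => (φ g.1, φ g.2)) (by fun_prop)).comp ψ,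
    fun g₁ g₂ g₃ => by
      have := congrArg ψ (f.2.2 (φ g₁) (φ g₂) (φ g₃))
      simpa [h] using this⟩
  map_zero' := by ext; simp
  map_add' f f' := by ext; simp

/-- The homomorphism `H²(G, M) → H²(G', M')` induced by a compatible pair. -/
def H2.map {ρ : G →* AddMonoid.End M} {ρ' : G' →* AddMonoid.End M'} (φ : G' →* G)
    (hφ : Continuous φ) (ψ : M →+ M') (h : ∀ g m, ψ (ρ (φ g) m) = ρ' g (ψ m)) :
    H2 ρ →+ H2 ρ' :=
  QuotientAddGroup.map _ _ (Z2.map φ hφ ψ h) <| by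
    rintro ⟨f, hf⟩ ⟨b, hb, hbf⟩
    refine ⟨fun g => ψ (b (φ g)), (IsLocallyConstant.comp_continuous hb hφ).comp ψ, ?_⟩
    ext g
    have := congrArg ψ (congrFun hbf (φ g.1, φ g.2))
    simpa [d1, Z2.map, h] using this

/-- `ℚ/ℤ`. -/
abbrev QZ : Type := ℚ ⧸ AddSubgroup.zmultiples (1 : ℚ)

/-- The character group `H¹(G, ℚ/ℤ)`. As `ℚ/ℤ` is a trivial discrete module, this is the group
of continuous `1`-cocycles, that is of continuous homomorphisms `G → ℚ/ℤ`. -/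
def Chars (G : Type*) [Group G] [TopologicalSpace G] : AddSubgroup (G → QZ) where
  carrier := {χ | IsLocallyConstant χ ∧ ∀ g h : G, χ (g * h) = χ g + χ h}
  zero_mem' := ⟨IsLocallyConstant.const 0, by simp⟩
  add_mem' {f f'} hf hf' := ⟨hf.1.add hf'.1, fun g h => by
    simp only [Pi.add_apply, hf.2 g h, hf'.2 g h]; abel⟩
  neg_mem' {f} hf := ⟨hf.1.neg, fun g h => by
    simp only [Pi.neg_apply, hf.2 g h]; abel⟩

/-- A lift of a character to a (continuous) `ℚ`-valued cochain. -/
def ratLift {G : Type*} (χ : G → QZ) : G → ℚ := fun g => (χ g).out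

theorem coe_ratLift {G : Type*} (χ : G → QZ) (g : G) : ((ratLift χ g : ℚ) : QZ) = χ g :=
  Quotient.out_eq' (χ g)

theorem floor_eq_of_coe_eq_zero {q : ℚ} (h : (q : QZ) = 0) : ((⌊q⌋ : ℤ) : ℚ) = q := by
  rw [QuotientAddGroup.eq_zero_iff, AddSubgroup.mem_zmultiples_iff] at h
  obtain ⟨n, rfl⟩ := h
  simp

/-- The cochain-level connecting map: lift `χ` to `ℚ` and take the (integral) coboundary. -/
def deltaFun (χ : G → QZ) : G × G → ℤ :=
  fun g => ⌊ratLift χ g.2 - ratLift χ (g.1 * g.2) + ratLift χ g.1⌋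

theorem deltaFun_cast (χ : Chars G) (g : G × G) : (deltaFun χ.1 g : ℚ) =
    ratLift χ.1 g.2 - ratLift χ.1 (g.1 * g.2) + ratLift χ.1 g.1 := by
  apply floor_eq_of_coe_eq_zero
  simp only [QuotientAddGroup.mk_add, QuotientAddGroup.mk_sub, coe_ratLift, χ.2.2]
  abel

/-- The connecting homomorphism `δ : H¹(G, ℚ/ℤ) → H²(G, ℤ)` attached to
`0 → ℤ → ℚ → ℚ/ℤ → 0` (trivial actions). -/
def delta [ContinuousMul G] : Chars G →+ H2 (1 : G →* AddMonoid.End ℤ) :=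
  AddMonoidHom.mk' (fun χ => H2.mk _ ⟨deltaFun χ.1, by
      have h : IsLocallyConstant (ratLift χ.1) := χ.2.1.comp Quotient.out
      exact (((h.comp_continuous (f := fun g : G × G => g.2) (by fun_prop)).sub
        (h.comp_continuous (f := fun g : G × G => g.1 * g.2) (by fun_prop))).add
        (h.comp_continuous (f := fun g : G × G => g.1) (by fun_prop))).comp Int.floor, by
      intro g₁ g₂ g₃
      have : ∀ n : ℤ, (n : ℚ) = 0 → n = 0 := fun n hn => by exact_mod_cast hn
      apply this
      simp only [MonoidHom.one_apply, AddMonoid.End.coe_one, id_eq]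
      push_cast
      simp only [deltaFun_cast, mul_assoc]
      ring⟩) <| by
    intro χ χ'
    rw [← map_add]
    refine QuotientAddGroup.eq.2 ?_
    have key : ∀ g, ((ratLift χ.1 g + ratLift χ'.1 g - ratLift (χ + χ').1 g : ℚ) : QZ) = 0 := by
      intro g
      simp only [QuotientAddGroup.mk_add, QuotientAddGroup.mk_sub, coe_ratLift]
      simp
    refine ⟨fun g => ⌊ratLift χ.1 g + ratLift χ'.1 g - ratLift (χ + χ').1 g⌋, ?_, ?_⟩
    · have h : ∀ χ : Chars G, IsLocallyConstant (ratLift χ.1) := fun χ => χ.2.1.comp Quotient.out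
      exact (((h χ).add (h χ')).sub (h (χ + χ'))).comp Int.floor
    · ext g
      have : ∀ n m : ℤ, (n : ℚ) = m → n = m := fun n m hn => by exact_mod_cast hn
      apply this
      have hsum := deltaFun_cast (χ + χ') g
      rw [AddSubgroup.coe_add] at hsum
      simp only [AddSubgroup.coe_add] at key
      simp only [d1, AddMonoidHom.coe_mk, ZeroHom.coe_mk, MonoidHom.one_apply,
        AddMonoid.End.coe_one, id_eq, AddSubgroup.subtype_apply, AddSubgroup.coe_add,
        NegMemClass.coe_neg, Pi.add_apply, Pi.neg_apply]
      push_cast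
      rw [floor_eq_of_coe_eq_zero (key _), floor_eq_of_coe_eq_zero (key _),
        floor_eq_of_coe_eq_zero (key _), hsum, deltaFun_cast, deltaFun_cast]
      ring

end Cohomology

/-! ## Subgroups of a topological group: conjugation and corestriction of characters -/

section Subgroups

variable {Γ : Type*} [Group Γ] [TopologicalSpace Γ]

/-- A character of `H`, seen on `H` as a subgroup of `G`. -/
def charHom (H G : Subgroup Γ) (χ : Chars H) : H.subgroupOf G →* Multiplicative QZ where
  toFun h := Multiplicative.ofAdd (χ.1 ⟨h.1.1, h.2⟩)
  map_one' := by
    have := χ.2.2 1 1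
    rw [one_mul, left_eq_add] at this
    exact this
  map_mul' a b := congrArg Multiplicative.ofAdd (χ.2.2 ⟨a.1.1, a.2⟩ ⟨b.1.1, b.2⟩)

theorem transfer_charHom_add (H G : Subgroup Γ) [(H.subgroupOf G).FiniteIndex] (χ χ' : Chars H)
    (g : G) : (charHom H G (χ + χ')).transfer g =
      (charHom H G χ).transfer g * (charHom H G χ').transfer g := by
  simp only [MonoidHom.transfer_def _ default]
  exact Finset.prod_mul_distrib

variable [IsTopologicalGroup Γ]

/-- For `γ⁻¹ H' γ ⊆ H`, the homomorphism `H' → H`, `g ↦ γ⁻¹ g γ`. -/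
def conjHom (γ : Γ) (H H' : Subgroup Γ) (h : ∀ g ∈ H', γ⁻¹ * g * γ ∈ H) : H' →* H where
  toFun g := ⟨γ⁻¹ * g * γ, h g g.2⟩
  map_one' := by ext; simp
  map_mul' a b := by ext; simp [mul_assoc]

theorem continuous_conjHom (γ : Γ) (H H' : Subgroup Γ) (h : ∀ g ∈ H', γ⁻¹ * g * γ ∈ H) :
    Continuous (conjHom γ H H' h) :=
  Continuous.subtype_mk (by fun_prop) _

/-- The action of `γ` on characters: `(γ χ)(g) = χ(γ⁻¹ g γ)`. -/
def conjChar (γ : Γ) (H H' : Subgroup Γ) (h : ∀ g ∈ H', γ⁻¹ * g * γ ∈ H) :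
    Chars H →+ Chars H' where
  toFun χ := ⟨fun g => χ.1 (conjHom γ H H' h g),
    χ.2.1.comp_continuous (continuous_conjHom γ H H' h),
    fun a b => by
      show χ.1 (conjHom γ H H' h (a * b)) = _
      rw [map_mul, χ.2.2]⟩
  map_zero' := rfl
  map_add' _ _ := rfl

theorem isLocallyConstant_transfer (H G : Subgroup Γ) [(H.subgroupOf G).FiniteIndex]
    (hH : IsOpen (H : Set Γ)) (χ : Chars H) :
    IsLocallyConstant fun g : G => ((charHom H G χ).transfer g).toAdd := by
  classical
  let T : (H.subgroupOf G).LeftTransversal := default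
  let α := T.2.leftQuotientEquiv
  let U : Set G := {g | ∃ h : g.1 ∈ H, χ.1 ⟨g.1, h⟩ = 0}
  have hU : IsOpen U := by
    have h1 : IsOpen {h : H | χ.1 h = 0} := χ.2.1.isOpen_fiber 0
    have h2 := (hH.isOpenMap_subtype_val _ h1).preimage (continuous_subtype_val (p := (· ∈ G)))
    convert! h2 using 1
    ext g
    simp [U]
  have hV : IsOpen (⋂ q : G ⧸ H.subgroupOf G, {g : G | ((α q : G))⁻¹ * g * (α q : G) ∈ U}) :=
    isOpen_iInter_of_finite fun q => hU.preimage (by fun_prop)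
  have hker : ∀ g ∈ (⋂ q : G ⧸ H.subgroupOf G, {g : G | ((α q : G))⁻¹ * g * (α q : G) ∈ U}),
      (charHom H G χ).transfer g = 1 := by
    intro g hg
    rw [MonoidHom.transfer_def _ T]
    refine Finset.prod_eq_one fun q _ => ?_
    have hgq := Set.mem_iInter.1 hg q
    obtain ⟨h, h0⟩ := hgq
    have hq : g⁻¹ • q = q := by
      have hα : ((α q : G) : G ⧸ H.subgroupOf G) = q := T.2.leftQuotientEquiv.symm_apply_apply q
      rw [inv_smul_eq_iff]
      conv_lhs => rw [← hα]
      conv_rhs => rw [← hα]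
      rw [MulAction.Quotient.smul_coe, smul_eq_mul, QuotientGroup.eq, Subgroup.mem_subgroupOf]
      simpa [mul_assoc] using h
    have hb : (((g • T).2.leftQuotientEquiv q : G)) = g * (α q : G) := by
      rw [Subgroup.smul_apply_eq_smul_apply_inv_smul, hq, smul_eq_mul]
    refine congrArg Multiplicative.ofAdd (Eq.trans ?_ h0)
    simp only [hb, mul_assoc]
    rfl
  rw [IsLocallyConstant.iff_eventually_eq]
  intro x
  have hx : ∀ᶠ y in nhds x, x⁻¹ * y ∈
      (⋂ q : G ⧸ H.subgroupOf G, {g : G | ((α q : G))⁻¹ * g * (α q : G) ∈ U}) := by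
    refine (hV.preimage (continuous_const_mul x⁻¹)).mem_nhds ?_
    refine Set.mem_iInter.2 fun q => ?_
    have h0 : χ.1 1 = 0 := by
      have := χ.2.2 1 1
      rwa [one_mul, left_eq_add] at this
    refine ⟨by simp, ?_⟩
    have h1 : ((α q : G))⁻¹ * (x⁻¹ * x) * (α q : G) = 1 := by simp
    have h2 : ∀ (g : G) (hg : g.1 ∈ H), g = 1 → χ.1 ⟨g.1, hg⟩ = 0 := by
      rintro g hg rfl; exact h0
    exact h2 _ _ h1
  filter_upwards [hx] with y hy
  have := hker _ hy
  rw [map_mul, map_inv, inv_mul_eq_one] at this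
  rw [this]

/-- Corestriction `H¹(H, ℚ/ℤ) → H¹(G, ℚ/ℤ)` for an open subgroup `H` of finite index in `G`. For
trivial coefficients the cochain formula for corestriction is the one for the transfer:
`(Cor χ)(g) = ∑_{q ∈ G/H} χ(t_q⁻¹ g t_{g⁻¹q})` with `t` a transversal. -/
def cor (H G : Subgroup Γ) [(H.subgroupOf G).FiniteIndex] (hH : IsOpen (H : Set Γ)) :
    Chars H →+ Chars G :=
  AddMonoidHom.mk' (fun χ => ⟨fun g => ((charHom H G χ).transfer g).toAdd,
      isLocallyConstant_transfer H G hH χ, fun a b => by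
        show ((charHom H G χ).transfer (a * b)).toAdd = _
        rw [map_mul, toAdd_mul]⟩) <| by
    intro χ χ'
    ext g
    simp [transfer_charHom_add]

/-- The induced module `A = Hom_H(G, ℤ)`: functions `x : G → ℤ` with `x(h g) = x(g)` for `h ∈ H`. -/
def Ind (H G : Subgroup Γ) : AddSubgroup (G → ℤ) where
  carrier := {x | ∀ h g : G, (h : Γ) ∈ H → x (h * g) = x g}
  zero_mem' := by simp
  add_mem' hx hy h g hh := by simp [hx h g hh, hy h g hh]
  neg_mem' hx h g hh := by simp [hx h g hh]

/-- The action `(g x)(g₁) = x(g₁ g)` of `G` on the induced module. -/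
def indRep (H G : Subgroup Γ) : G →* AddMonoid.End (Ind H G) where
  toFun g :=
    { toFun := fun x => ⟨fun g₁ => x.1 (g₁ * g), fun h g₁ hh => by
        show x.1 (h * g₁ * g) = x.1 (g₁ * g)
        rw [mul_assoc]; exact x.2 h _ hh⟩
      map_zero' := rfl
      map_add' := fun _ _ => rfl }
  map_one' := by
    ext x g
    show x.1 (g * 1) = x.1 g
    rw [mul_one]
  map_mul' a b := by
    ext x g
    show x.1 (g * (a * b)) = x.1 (g * a * b)
    rw [mul_assoc]

/-- The inverse of the Shapiro isomorphism, `sh⁻¹ : H²(G, A) → H²(H, ℤ)`, induced by `H ⊆ G` and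
`A → ℤ`, `x ↦ x(1)`. -/
def shapiroInv (H G : Subgroup Γ) (hle : H ≤ G) :
    H2 (indRep H G) →+ H2 (1 : H →* AddMonoid.End ℤ) :=
  H2.map (Subgroup.inclusion hle) (continuous_inclusion hle)
    ((Pi.evalAddMonoidHom _ 1).comp (Ind H G).subtype) <| by
    intro g x
    have := x.2 (Subgroup.inclusion hle g) 1 g.2
    rw [mul_one] at this
    show x.1 (1 * Subgroup.inclusion hle g) = x.1 1
    rwa [one_mul]

end Subgroups

/-! ## Actions on multiplicative groups of fields -/

section Fields

variable {k K : Type*} [Field k] [Field K] [Algebra k K]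

/-- The representation of `G` on `Lˣ` (written additively) given by field endomorphisms of `L`. -/
def unitsRep {G L : Type*} [Group G] [Field L] (Θ : G →* (L →+* L)) :
    G →* AddMonoid.End (Additive Lˣ) where
  toFun g := MonoidHom.toAdditive (Units.map (Θ g).toMonoidHom)
  map_one' := by
    ext x
    show Θ 1 (x.toMul : L) = x.toMul
    rw [map_one]; rfl
  map_mul' a b := by
    ext x
    show Θ (a * b) (x.toMul : L) = Θ a (Θ b (x.toMul : L))
    rw [map_mul]; rfl

/-- The natural action of `Gal(K/k)` on `K`. -/
def galHom (k K : Type*) [Field k] [Field K] [Algebra k K] : Gal(K/k) →* (K →+* K) where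
  toFun γ := (γ : K →+* K)
  map_one' := rfl
  map_mul' _ _ := rfl

/-- The action of a field endomorphism on the coefficients of rational functions. -/
def coeffMap (φ : K →+* K) : RatFunc K →+* RatFunc K :=
  RatFunc.mapRingHom (Polynomial.mapRingHom φ) <| by
    intro p hp
    simp only [Submonoid.mem_comap, mem_nonZeroDivisors_iff_ne_zero] at hp ⊢
    exact (Polynomial.map_ne_zero_iff φ.injective).2 hp

@[simp] theorem coeffMap_algebraMap (φ : K →+* K) (p : K[X]) :
    coeffMap φ (algebraMap K[X] (RatFunc K) p) = algebraMap K[X] (RatFunc K) (p.map φ) := by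
  rw [coeffMap, RatFunc.coe_mapRingHom_eq_coe_map]
  simpa using RatFunc.map_apply_div (Polynomial.mapRingHom φ) _ p 1

@[simp] theorem coeffMap_C (φ : K →+* K) (a : K) :
    coeffMap φ (RatFunc.C a) = RatFunc.C (φ a) := by
  rw [← RatFunc.algebraMap_C, coeffMap_algebraMap, Polynomial.map_C, RatFunc.algebraMap_C]

@[simp] theorem coeffMap_X (φ : K →+* K) : coeffMap φ (RatFunc.X : RatFunc K) = RatFunc.X := by
  rw [← RatFunc.algebraMap_X, coeffMap_algebraMap, Polynomial.map_X]

theorem ratFunc_hom_ext {L : Type*} [Field L] {f g : RatFunc K →+* L}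
    (hC : ∀ a, f (RatFunc.C a) = g (RatFunc.C a)) (hX : f RatFunc.X = g RatFunc.X) : f = g := by
  apply IsLocalization.ringHom_ext (nonZeroDivisors K[X])
  apply Polynomial.ringHom_ext
  · intro a; simpa using hC a
  · simpa using hX

/-- The coefficientwise action of `Gal(K/k)` on `K(u)` (with `u` fixed). -/
def coeffHom (k K : Type*) [Field k] [Field K] [Algebra k K] :
    Gal(K/k) →* (RatFunc K →+* RatFunc K) where
  toFun γ := coeffMap (γ : K →+* K)
  map_one' := ratFunc_hom_ext (by simp) (by simp)
  map_mul' a b := ratFunc_hom_ext (by simp) (by simp)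

theorem X_ne_C (a : K) : (RatFunc.X : RatFunc K) ≠ RatFunc.C a := by
  rw [← RatFunc.algebraMap_X, ← RatFunc.algebraMap_C]
  intro h
  exact Polynomial.X_ne_C a (RatFunc.algebraMap_injective K h)

theorem X_ne_zero : (RatFunc.X : RatFunc K) ≠ 0 := by simpa using X_ne_C (0 : K)

/-- The `K`-endomorphism of `K(u)` with `u ↦ c / u`, for `c ≠ 0`. -/
def swapMap (c : K) (hc : c ≠ 0) : RatFunc K →ₐ[K] RatFunc K :=
  RatFunc.liftAlgHom (Polynomial.aeval (RatFunc.C c / RatFunc.X)) <| by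
    have ht : Transcendental K (RatFunc.C c / RatFunc.X : RatFunc K) := by
      apply RatFunc.transcendental_of_ne_C
      rintro ⟨a, ha⟩
      have hX := X_ne_zero (K := K)
      have hc' : (RatFunc.C c : RatFunc K) ≠ 0 := by simpa using hc
      have ha0 : (RatFunc.C a : RatFunc K) ≠ 0 := ha ▸ div_ne_zero hc' hX
      apply X_ne_C (c / a)
      rw [map_div₀, ← ha]
      field_simp
    intro p hp
    simp only [Submonoid.mem_comap, mem_nonZeroDivisors_iff_ne_zero] at hp ⊢
    exact fun h0 => ht ⟨p, hp, h0⟩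

theorem swapMap_C (c : K) (hc : c ≠ 0) (a : K) : swapMap c hc (RatFunc.C a) = RatFunc.C a :=
  (swapMap c hc).commutes a

theorem swapMap_X (c : K) (hc : c ≠ 0) : swapMap c hc RatFunc.X = RatFunc.C c / RatFunc.X := by
  have := RatFunc.liftAlgHom_apply_div (L := RatFunc K) (S := K) (K := K)
    (Polynomial.aeval (RatFunc.C c / RatFunc.X : RatFunc K)) ?_ Polynomial.X 1
  · simpa [swapMap] using this

end Fields

/-! ## The genus zero setting -/

section Setting

/-- The indexing set of the polynomials `p`: monic irreducible elements of `l[u]`, other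
than `u`. -/
abbrev Place {k K : Type*} [Field k] [Field K] [Algebra k K] (l : IntermediateField k K) : Type _ :=
  {p : (l)[X] // p.Monic ∧ Irreducible p ∧ p ≠ Polynomial.X}

/-- The data and choices that are fixed throughout, inside an algebraic closure `K` of `k`. -/
structure Datum (k K : Type*) [Field k] [Field K] [Algebra k K] where
  /-- the coefficients of the conic `1 = c x² + d y²` -/
  c : k
  d : k
  c_ne_zero : c ≠ 0
  d_not_square : ¬ IsSquare d
  /-- the chosen square root of `d`, so that `l = k(√d)` -/
  sqrtd : K
  sqrtd_sq : sqrtd ^ 2 = algebraMap k K d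
  /-- an extension to `K` of the nontrivial automorphism of `l / k` -/
  σ : Gal(K/k)
  σ_sqrtd : σ sqrtd ≠ sqrtd
  /-- a chosen root `a_p` of every `p` -/
  root : Place (IntermediateField.adjoin k {sqrtd}) → K
  aeval_root : ∀ p, Polynomial.aeval (root p) p.1 = 0

variable {k K : Type*} [Field k] [Field K] [Algebra k K]

namespace Datum

variable (D : Datum k K)

/-- The quadratic extension `l = k(√d)`. -/
abbrev l : IntermediateField k K := IntermediateField.adjoin k {D.sqrtd}

/-- The absolute Galois group `G_l`, as a subgroup of `G_k = Gal(K/k)`. -/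
def G : Subgroup Gal(K/k) := D.l.fixingSubgroup

/-- The field `l(a_p) = k(√d, a_p)`. -/
def lRoot (p : Place D.l) : IntermediateField k K :=
  IntermediateField.adjoin k {D.sqrtd, D.root p}

/-- The absolute Galois group of `l(a_p)`, as a subgroup of `G_k`. -/
def H (p : Place D.l) : Subgroup Gal(K/k) := (D.lRoot p).fixingSubgroup

theorem mem_fixingSubgroup_adjoin {S : Set K} {γ : Gal(K/k)} :
    γ ∈ (IntermediateField.adjoin k S).fixingSubgroup ↔ ∀ a ∈ S, γ a = a := by
  rw [IntermediateField.mem_fixingSubgroup_iff]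
  refine ⟨fun h a ha => h a (IntermediateField.subset_adjoin k S ha), fun h x hx => ?_⟩
  induction hx using IntermediateField.adjoin_induction with
  | mem x hx => exact h x hx
  | algebraMap x => exact γ.commutes x
  | add x y _ _ hx hy => rw [map_add, hx, hy]
  | inv x _ hx => rw [map_inv₀, hx]
  | mul x y _ _ hx hy => rw [map_mul, hx, hy]

theorem mem_G {γ : Gal(K/k)} : γ ∈ D.G ↔ γ D.sqrtd = D.sqrtd := by
  rw [G, mem_fixingSubgroup_adjoin]; simp

theorem mem_H {p : Place D.l} {γ : Gal(K/k)} :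
    γ ∈ D.H p ↔ γ D.sqrtd = D.sqrtd ∧ γ (D.root p) = D.root p := by
  rw [H, lRoot, mem_fixingSubgroup_adjoin]; simp

theorem H_le (p : Place D.l) : D.H p ≤ D.G := fun _ hγ => D.mem_G.2 (D.mem_H.1 hγ).1

theorem gal_sqrtd (γ : Gal(K/k)) : γ D.sqrtd = D.sqrtd ∨ γ D.sqrtd = -D.sqrtd := by
  apply sq_eq_sq_iff_eq_or_eq_neg.1
  rw [← map_pow, D.sqrtd_sq, γ.commutes]

theorem conj_mem_G (γ : Gal(K/k)) : ∀ g ∈ D.G, γ⁻¹ * g * γ ∈ D.G := by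
  intro g hg
  rw [mem_G] at hg ⊢
  have hinv : γ⁻¹ (γ D.sqrtd) = D.sqrtd := by
    rw [← AlgEquiv.mul_apply, inv_mul_cancel, AlgEquiv.one_apply]
  simp only [AlgEquiv.mul_apply]
  rcases D.gal_sqrtd γ with h | h
  · rw [h, hg]; rwa [h] at hinv
  · rw [h, map_neg, hg]; rwa [h] at hinv

theorem isOpen_H [Algebra.IsAlgebraic k K] (p : Place D.l) : IsOpen (D.H p : Set Gal(K/k)) := by
  have : FiniteDimensional k (D.lRoot p) :=
    IntermediateField.finiteDimensional_adjoin fun x _ => Algebra.IsIntegral.isIntegral x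
  exact (D.lRoot p).fixingSubgroup_isOpen

theorem finiteIndex_H [PerfectField k] [IsAlgClosure k K] (p : Place D.l) :
    (D.H p).FiniteIndex := by
  have : Algebra.IsAlgebraic k K := IsAlgClosure.isAlgebraic
  have : Normal k K := IsAlgClosure.normal k K
  have : IsGalois k K := {}
  have : FiniteDimensional k (D.lRoot p) :=
    IntermediateField.finiteDimensional_adjoin fun x _ => Algebra.IsIntegral.isIntegral x
  constructor
  rw [H, ← IntermediateField.finrank_eq_fixingSubgroup_index]
  exact Module.finrank_pos.ne'

/-! ### Brauer groups, character groups and their natural Galois actions -/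

/-- The `G_l`-module `Kˣ`. -/
def constRep : D.G →* AddMonoid.End (Additive Kˣ) := (unitsRep (galHom k K)).comp D.G.subtype

/-- `Br(l) = H²(G_l, Kˣ)`. -/
abbrev Br : Type _ := H2 D.constRep

/-- The `G_l`-module `K(u)ˣ`, with trivial action on `u`. -/
def ratRep : D.G →* AddMonoid.End (Additive (RatFunc K)ˣ) :=
  (unitsRep (coeffHom k K)).comp D.G.subtype

/-- `Br(l(u)) = H²(G_l, K(u)ˣ)`. -/
abbrev BrRat : Type _ := H2 D.ratRep

/-- The map `γ ↦ σ⁻¹ γ σ` on `G_l`. -/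
def conjσ : D.G →* D.G := conjHom D.σ D.G D.G (D.conj_mem_G D.σ)

theorem continuous_conjσ : Continuous D.conjσ := continuous_conjHom _ _ _ _

theorem σ_mul_conjσ (g : D.G) : D.σ * (D.conjσ g : Gal(K/k)) = g * D.σ := by
  simp [conjσ, conjHom, mul_assoc]

/-- The natural action of `σ` on `Br(l)`: `h ↦ σ (h (σ⁻¹ g₁ σ, σ⁻¹ g₂ σ))`. -/
def σBr : D.Br →+ D.Br :=
  H2.map D.conjσ D.continuous_conjσ (unitsRep (galHom k K) D.σ) <| by
    intro g m
    have h := congrArg (unitsRep (galHom k K)) (D.σ_mul_conjσ g)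
    rw [map_mul, map_mul] at h
    exact DFunLike.congr_fun h m

/-- The natural action of `σ` on `X(l)`: `(σ χ)(g) = χ(σ⁻¹ g σ)`. -/
def σChar : Chars D.G →+ Chars D.G := conjChar D.σ D.G D.G (D.conj_mem_G D.σ)

/-- `Cor : X(l(a_p)) → X(l)`. -/
def corAt [PerfectField k] [IsAlgClosure k K] (p : Place D.l) : Chars (D.H p) →+ Chars D.G :=
  haveI := D.finiteIndex_H p
  haveI : Algebra.IsAlgebraic k K := IsAlgClosure.isAlgebraic
  cor (D.H p) D.G (D.isOpen_H p)

open Classical in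
/-- `Cor : ⊕ X(l(a_p)) → X(l)`, the sum of the corestrictions. -/
def corSum [PerfectField k] [IsAlgClosure k K] :
    (DirectSum (Place D.l) fun p => Chars (D.H p)) →+ Chars D.G :=
  DirectSum.toAddMonoid D.corAt

/-! ### The automorphism `s` and its action on `Br(l(u))` -/

theorem c_ne_zero' : algebraMap k K D.c ≠ 0 :=
  (map_ne_zero (algebraMap k K)).2 D.c_ne_zero

/-- The automorphism `s` of `K(u)` extending `σ`, with `s(u) = c / u`. -/
def s : RatFunc K →+* RatFunc K :=
  (swapMap (algebraMap k K D.c) D.c_ne_zero' : RatFunc K →+* RatFunc K).comp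
    (coeffMap (D.σ : K →+* K))

theorem s_C (a : K) : D.s (RatFunc.C a) = RatFunc.C (D.σ a) := by
  simp [s, swapMap_C]

theorem s_X : D.s RatFunc.X = RatFunc.C (algebraMap k K D.c) / RatFunc.X := by
  simp [s, swapMap_X]

/-- The coordinate `x = 2 / (u + c/u)` on the conic. -/
def x : RatFunc K := 2 / (RatFunc.X + RatFunc.C (algebraMap k K D.c) / RatFunc.X)

/-- The coordinate `y = (2u / (u + c/u) - 1) / √d` on the conic. -/
def y : RatFunc K :=
  (2 * RatFunc.X / (RatFunc.X + RatFunc.C (algebraMap k K D.c) / RatFunc.X) - 1) /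
    RatFunc.C D.sqrtd

/-- The automorphism `s` fixes the coordinate `x`. -/
theorem s_x : D.s D.x = D.x := by
  have hX := X_ne_zero (K := K)
  have hc : (RatFunc.C (algebraMap k K D.c) : RatFunc K) ≠ 0 := by simpa using D.c_ne_zero
  simp only [x, map_div₀, map_add, s_X, s_C, AlgEquiv.commutes, map_ofNat]
  rw [div_div_cancel₀ hc, add_comm]

theorem add_ne_zero' :
    (RatFunc.X + RatFunc.C (algebraMap k K D.c) / RatFunc.X : RatFunc K) ≠ 0 := by
  have hX := X_ne_zero (K := K)
  intro h
  have h2 : (RatFunc.X : RatFunc K) ^ 2 + RatFunc.C (algebraMap k K D.c) = 0 := by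
    have := congrArg (· * RatFunc.X) h
    simp only [add_mul, div_mul_cancel₀ _ hX, zero_mul] at this
    rw [sq]; exact this
  rw [← RatFunc.algebraMap_X, ← RatFunc.algebraMap_C, ← map_pow, ← map_add,
    map_eq_zero_iff _ (RatFunc.algebraMap_injective K)] at h2
  exact (Polynomial.monic_X_pow_add_C _ two_ne_zero).ne_zero h2

theorem sqrtd_ne_zero : D.sqrtd ≠ 0 := fun h => D.σ_sqrtd (by rw [h, map_zero])

/-- The automorphism `s` fixes the coordinate `y`. -/
theorem s_y : D.s D.y = D.y := by
  have hX := X_ne_zero (K := K)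
  have hc : (RatFunc.C (algebraMap k K D.c) : RatFunc K) ≠ 0 := by simpa using D.c_ne_zero
  have hd : (RatFunc.C D.sqrtd : RatFunc K) ≠ 0 := by simpa using D.sqrtd_ne_zero
  have hσ : D.σ D.sqrtd = -D.sqrtd := (D.gal_sqrtd D.σ).resolve_left D.σ_sqrtd
  have h0 := D.add_ne_zero'
  simp only [y, map_div₀, map_sub, map_mul, map_add, s_X, s_C, AlgEquiv.commutes, map_ofNat,
    map_one, hσ, map_neg, div_div_cancel₀ hc]
  rw [add_comm (RatFunc.C (algebraMap k K D.c) / RatFunc.X)]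
  generalize hw : (RatFunc.C (algebraMap k K D.c) / RatFunc.X : RatFunc K) = w at h0 ⊢
  field_simp
  ring

/-- The variable `u` is `(1 + √d y) / x`. -/
theorem X_eq : (RatFunc.X : RatFunc K) = (1 + RatFunc.C D.sqrtd * D.y) / D.x := by
  have hd : (RatFunc.C D.sqrtd : RatFunc K) ≠ 0 := by simpa using D.sqrtd_ne_zero
  have h0 := D.add_ne_zero'
  have h2 : (2 : RatFunc K) ≠ 0 := by
    intro h
    have hσ : D.σ D.sqrtd = -D.sqrtd := (D.gal_sqrtd D.σ).resolve_left D.σ_sqrtd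
    have h2K : (2 : K) = 0 := by
      apply (RatFunc.C : K →+* RatFunc K).injective
      rw [map_zero, map_ofNat, h]
    apply D.σ_sqrtd
    rw [hσ, neg_eq_iff_add_eq_zero, ← two_mul, h2K, zero_mul]
  rw [x, y, mul_div_cancel₀ _ hd, add_sub_cancel, div_div_div_cancel_right₀ h0,
    mul_div_cancel_left₀ _ h2]

/-- The coordinates satisfy the equation of the conic. -/
theorem conic : 1 - RatFunc.C (algebraMap k K D.c) * D.x ^ 2 -
    RatFunc.C (algebraMap k K D.d) * D.y ^ 2 = 0 := by
  have hX := X_ne_zero (K := K)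
  have hd : (RatFunc.C D.sqrtd : RatFunc K) ≠ 0 := by simpa using D.sqrtd_ne_zero
  have h0 := D.add_ne_zero'
  rw [← D.sqrtd_sq, map_pow, x, y]
  generalize hw : (RatFunc.C (algebraMap k K D.c) / RatFunc.X : RatFunc K) = w at h0 ⊢
  rw [div_eq_iff hX] at hw
  rw [hw]
  field_simp
  ring

/-- The map `s` on `K(u)ˣ`. -/
def sUnits : Additive (RatFunc K)ˣ →+ Additive (RatFunc K)ˣ :=
  MonoidHom.toAdditive (Units.map D.s.toMonoidHom)

theorem s_comp (g : D.G) : D.s.comp (coeffHom k K (D.conjσ g)) =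
    (coeffHom k K g).comp D.s := by
  apply ratFunc_hom_ext
  · intro a
    have h := DFunLike.congr_fun (D.σ_mul_conjσ g) a
    simp only [AlgEquiv.mul_apply] at h
    simp [coeffHom, s_C, h]
  · simp [coeffHom, s_X]

/-- The action of `s` on `Br(l(u))`: `s^*` sends a `2`-cocycle `h` to
`(g₁, g₂) ↦ s (h (σ⁻¹ g₁ σ, σ⁻¹ g₂ σ))`. -/
def sStar : D.BrRat →+ D.BrRat :=
  H2.map D.conjσ D.continuous_conjσ D.sUnits <| by
    intro g m
    apply Additive.toMul.injective
    ext
    exact DFunLike.congr_fun (D.s_comp g) (m.toMul : RatFunc K)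

/-! ### The action `p ↦ p̃` -/

theorem root_ne_zero (p : Place D.l) : D.root p ≠ 0 := by
  intro h
  have hp := D.aeval_root p
  rw [h, Polynomial.aeval_def, Polynomial.eval₂_at_zero, map_eq_zero,
    ← Polynomial.X_dvd_iff] at hp
  exact p.2.2.2 (Polynomial.eq_of_monic_of_associated p.2.1 Polynomial.monic_X
    (Polynomial.irreducible_X.associated_of_dvd p.2.2.1 hp).symm)

/-- Elements of `G_l` commute with evaluation of polynomials over `l`. -/
theorem aeval_apply_of_mem {γ : Gal(K/k)} (hγ : γ ∈ D.G) (q : (D.l)[X]) (a : K) :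
    Polynomial.aeval (γ a) q = γ (Polynomial.aeval a q) :=
  Polynomial.aeval_algHom_apply
    ((IntermediateField.fixingSubgroupEquiv D.l ⟨γ, hγ⟩ : K ≃ₐ[D.l] K) : K →ₐ[D.l] K) a q

theorem exists_mem_G_of_root [PerfectField k] [IsAlgClosure k K] (p : Place D.l) {a b : K}
    (ha : Polynomial.aeval a p.1 = 0) (hb : Polynomial.aeval b p.1 = 0) :
    ∃ τ ∈ D.G, τ a = b := by
  have : Normal k K := IsAlgClosure.normal k K
  have : Normal D.l K := Normal.tower_top_of_normal k D.l K
  have h : IsConjRoot D.l b a := by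
    rw [isConjRoot_def, ← minpoly.eq_of_irreducible_of_monic p.2.2.1 hb p.2.1,
      ← minpoly.eq_of_irreducible_of_monic p.2.2.1 ha p.2.1]
  obtain ⟨τ, hτ⟩ := isConjRoot_iff_exists_algEquiv.1 h
  exact ⟨((IntermediateField.fixingSubgroupEquiv D.l).symm τ).1,
    ((IntermediateField.fixingSubgroupEquiv D.l).symm τ).2, hτ⟩

/-- The polynomial `p̃`: the monic irreducible polynomial over `l` whose roots are the
`c / σ(a)`, for `a` running over the roots of `p`; see `rootSet_tilde`. -/
def tilde [IsAlgClosure k K] (p : Place D.l) : Place D.l :=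
  ⟨minpoly D.l (algebraMap k K D.c / D.σ (D.root p)), by
    have : Algebra.IsAlgebraic k K := IsAlgClosure.isAlgebraic
    have hint : IsIntegral D.l (algebraMap k K D.c / D.σ (D.root p)) :=
      Algebra.IsIntegral.isIntegral _
    refine ⟨minpoly.monic hint, minpoly.irreducible hint, fun h => ?_⟩
    have h0 := minpoly.aeval D.l (algebraMap k K D.c / D.σ (D.root p))
    rw [h, Polynomial.aeval_X] at h0
    exact div_ne_zero D.c_ne_zero' ((map_ne_zero D.σ).2 (D.root_ne_zero p)) h0⟩

theorem rootSet_tilde [PerfectField k] [IsAlgClosure k K] (p : Place D.l) :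
    (D.tilde p).1.rootSet K = (fun a => algebraMap k K D.c / D.σ a) '' p.1.rootSet K := by
  have h0 : Polynomial.aeval (algebraMap k K D.c / D.σ (D.root p)) (D.tilde p).1 = 0 :=
    minpoly.aeval _ _
  have hc := D.c_ne_zero'
  have hinv : ∀ z, D.σ⁻¹ (D.σ z) = z := fun z => by
    rw [← AlgEquiv.mul_apply, inv_mul_cancel, AlgEquiv.one_apply]
  have hinv' : ∀ z, D.σ (D.σ⁻¹ z) = z := fun z => by
    rw [← AlgEquiv.mul_apply, mul_inv_cancel, AlgEquiv.one_apply]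
  ext b
  simp only [Set.mem_image, Polynomial.mem_rootSet_of_ne (D.tilde p).2.1.ne_zero,
    Polynomial.mem_rootSet_of_ne p.2.1.ne_zero]
  constructor
  · intro hb
    obtain ⟨τ, hτ, rfl⟩ := D.exists_mem_G_of_root (D.tilde p) h0 hb
    refine ⟨(D.σ⁻¹ * τ * D.σ) (D.root p), ?_, ?_⟩
    · rw [D.aeval_apply_of_mem (D.conj_mem_G _ _ hτ), D.aeval_root, map_zero]
    · simp only [AlgEquiv.mul_apply, hinv', map_div₀, AlgEquiv.commutes]
  · rintro ⟨a, ha, rfl⟩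
    obtain ⟨τ, hτ, rfl⟩ := D.exists_mem_G_of_root p (D.aeval_root p) ha
    have h1 : algebraMap k K D.c / D.σ (τ (D.root p)) =
        ((D.σ⁻¹)⁻¹ * τ * D.σ⁻¹) (algebraMap k K D.c / D.σ (D.root p)) := by
      simp only [AlgEquiv.mul_apply, map_div₀, AlgEquiv.commutes, hinv, inv_inv]
    rw [h1, D.aeval_apply_of_mem (D.conj_mem_G _ _ hτ), h0, map_zero]

/-! ### The Auslander-Brumer-Faddeev decomposition -/

/-- The inclusion `Br(l) → Br(l(u))` induced by `Kˣ ⊆ K(u)ˣ`. -/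
def constMap : D.Br →+ D.BrRat :=
  H2.map (MonoidHom.id _) continuous_id
    (MonoidHom.toAdditive (Units.map (RatFunc.C : K →+* RatFunc K).toMonoidHom)) <| by
    intro g m
    apply Additive.toMul.injective
    ext
    exact (coeffMap_C _ (m.toMul : K)).symm

/-- The unit `u` of `K(u)`. -/
def uUnit (K : Type*) [Field K] : (RatFunc K)ˣ := Units.mk0 RatFunc.X X_ne_zero

/-- The map `π^* : H²(G_l, ℤ) → Br(l(u))` induced by `π : ℤ → K(u)ˣ`, `π(e) = u ^ e`. -/
def piMap : H2 (1 : D.G →* AddMonoid.End ℤ) →+ D.BrRat :=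
  H2.map (MonoidHom.id _) continuous_id
    (zmultiplesHom _ (Additive.ofMul (uUnit K))) <| by
    intro g e
    apply Additive.toMul.injective
    ext
    show ((uUnit K ^ e : (RatFunc K)ˣ) : RatFunc K) =
      coeffMap _ ((uUnit K ^ e : (RatFunc K)ˣ) : RatFunc K)
    simp [uUnit]

/-- The unit `u - a` of `K(u)`. -/
def linUnit (a : K) : (RatFunc K)ˣ :=
  Units.mk0 (RatFunc.X - RatFunc.C a) (sub_ne_zero.2 (X_ne_C a))

/-- The factor `(u - τ(a_p)) ^ x(τ⁻¹)` for a coset `τ H` in `G_l / G_{l(a_p)}`. -/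
def iotaTerm (p : Place D.l) (x : Ind (D.H p) D.G) : D.G ⧸ (D.H p).subgroupOf D.G → (RatFunc K)ˣ :=
  Quotient.lift (fun τ : D.G => linUnit ((τ : Gal(K/k)) (D.root p)) ^ x.1 τ⁻¹) <| by
    intro τ τ' h
    have h : τ⁻¹ * τ' ∈ (D.H p).subgroupOf D.G := QuotientGroup.leftRel_apply.1 h
    rw [Subgroup.mem_subgroupOf] at h
    have h1 : (τ' : Gal(K/k)) (D.root p) = (τ : Gal(K/k)) (D.root p) := by
      have := congrArg (τ : Gal(K/k)) (D.mem_H.1 h).2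
      simpa [← AlgEquiv.mul_apply] using this
    have h2 : x.1 τ⁻¹ = x.1 τ'⁻¹ := by
      rw [← x.2 (τ⁻¹ * τ') τ'⁻¹ h]; simp
    show linUnit _ ^ _ = linUnit _ ^ _
    rw [h1, h2]

section ABF

variable [PerfectField k] [IsAlgClosure k K]

/-- The homomorphism `ι : A → K(u)ˣ`, `ι(x) = ∏_{τ H} (u - τ(a_p)) ^ x(τ⁻¹)`; it is an isomorphism
of `A` onto the subgroup generated by the `u - a` with `p(a) = 0`. -/
def iota (p : Place D.l) : Ind (D.H p) D.G →+ Additive (RatFunc K)ˣ :=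
  AddMonoidHom.mk' (fun x => Additive.ofMul (∏ᶠ q, D.iotaTerm p x q)) <| by
    intro x x'
    have := D.finiteIndex_H p
    rw [← ofMul_mul, ← finprod_mul_distrib (Set.toFinite _) (Set.toFinite _)]
    congr 1
    refine finprod_congr fun q => ?_
    induction q using Quotient.inductionOn with
    | h τ => exact zpow_add _ _ _

theorem iota_equivariant (p : Place D.l) (g : D.G) (x : Ind (D.H p) D.G) :
    D.iota p (indRep (D.H p) D.G g x) = D.ratRep g (D.iota p x) := by
  have := D.finiteIndex_H p
  apply Additive.toMul.injective
  show ∏ᶠ q, D.iotaTerm p (indRep (D.H p) D.G g x) q =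
    Units.map (coeffHom k K g).toMonoidHom (∏ᶠ q, D.iotaTerm p x q)
  rw [MonoidHom.map_finprod _ (Set.toFinite _),
    ← finprod_comp_equiv (MulAction.toPerm g : Equiv.Perm (D.G ⧸ (D.H p).subgroupOf D.G))]
  refine finprod_congr fun q => ?_
  induction q using Quotient.inductionOn with
  | h τ =>
    show linUnit (((g * τ : D.G) : Gal(K/k)) (D.root p)) ^ x.1 ((g * τ)⁻¹ * g) =
      Units.map (coeffHom k K g).toMonoidHom (linUnit ((τ : Gal(K/k)) (D.root p)) ^ x.1 τ⁻¹)
    rw [map_zpow, mul_inv_rev, inv_mul_cancel_right]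
    congr 1
    ext
    simp [linUnit, coeffHom]

/-- The map `H²(G_l, A) → Br(l(u))` induced by `ι`. -/
def iotaMap (p : Place D.l) : H2 (indRep (D.H p) D.G) →+ D.BrRat :=
  H2.map (MonoidHom.id _) continuous_id (D.iota p) (D.iota_equivariant p)

/-- The group `Br(l) ⊕ X(l) ⊕ (⊕_p X(l(a_p)))`. -/
abbrev Dec : Type _ :=
  D.Br × Chars D.G × DirectSum (Place D.l) fun p => Chars (D.H p)

open Classical in
/-- The inclusion of the summand `X(l(a_p))`. -/
def inclAt (p : Place D.l) : Chars (D.H p) →+ D.Dec :=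
  (AddMonoidHom.inr _ _).comp
    ((AddMonoidHom.inr _ _).comp (DirectSum.of (fun p => Chars (D.H p)) p))

/-- `e` is the Auslander-Brumer-Faddeev isomorphism: on `Br(l)` it is induced by the inclusion
of constants, on `X(l)` it is `π^* ∘ δ`, and on `X(l(a_p))` it is `ι^* ∘ sh ∘ δ`. -/
structure IsABF (e : D.Dec ≃+ D.BrRat) : Prop where
  const : ∀ β : D.Br, e (β, 0, 0) = D.constMap β
  atU : ∀ χ : Chars D.G, e (0, χ, 0) = D.piMap (delta χ)
  atP : ∀ (p : Place D.l) (χ : Chars (D.H p)),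
    ∃ y : H2 (indRep (D.H p) D.G), shapiroInv (D.H p) D.G (D.H_le p) y = delta χ ∧
      e (D.inclAt p χ) = D.iotaMap p y

/-! ### The components of `s^*` in the decomposition -/

variable (e : D.Dec ≃+ D.BrRat)

/-- The action `s^*` carried over to the decomposition. -/
def sDec : D.Dec →+ D.Dec := (e.symm : D.BrRat →+ D.Dec).comp (D.sStar.comp (e : D.Dec →+ D.BrRat))

/-- The component `X(l(a_p)) → X(l(a_q))` of `s^*`. -/
def sPQ (p q : Place D.l) : Chars (D.H p) →+ Chars (D.H q) where
  toFun χ := (D.sDec e (D.inclAt p χ)).2.2 q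
  map_zero' := by simp
  map_add' := by simp

/-- The component `s_{p1}^* : X(l(a_p)) → Br(l)` of `s^*`. -/
def sP1 (p : Place D.l) : Chars (D.H p) →+ D.Br :=
  (AddMonoidHom.fst _ _).comp ((D.sDec e).comp (D.inclAt p))

/-- The component `s_{u1}^* : X(l) → Br(l)` of `s^*`. -/
def sU1 : Chars D.G →+ D.Br :=
  (AddMonoidHom.fst _ _).comp
    ((D.sDec e).comp ((AddMonoidHom.inr _ _).comp (AddMonoidHom.inl _ _)))

open Classical in
/-- The map `s_1^* = s_{u1}^* + ∑_p s_{p1}^*`. -/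
def s1 : Chars D.G × (DirectSum (Place D.l) fun p => Chars (D.H p)) →+ D.Br :=
  (D.sU1 e).coprod (DirectSum.toAddMonoid (D.sP1 e))

end ABF

end Datum

end Setting

end

end GenusZero

set_option linter.unusedSectionVars false

namespace GenusZero

noncomputable section

/-! ## Generalities on `H²` -/

section Functoriality

variable {G G' G'' M M' M'' : Type*} [Group G] [TopologicalSpace G] [Group G'] [TopologicalSpace G']
  [Group G''] [TopologicalSpace G''] [AddCommGroup M] [AddCommGroup M'] [AddCommGroup M'']
  {ρ : G →* AddMonoid.End M} {ρ' : G' →* AddMonoid.End M'} {ρ'' : G'' →* AddMonoid.End M''}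

/-! Since $\bar k$ is algebraically closed, factorization into linear factors, grouped by
$G_l$-orbits of roots, is an isomorphism of $G_l$-modules $\bar k(u)^* = \bar k^* \oplus u^{\mathbb
Z} \oplus \bigoplus_p A_p$. The projections are the leading coefficient, the order at $0$ and the
divisor along $p$ (`lead`, `ordAt`, `valAt`). A continuous cocycle on a compact group takes finitely
many values, so $H^2$ commutes with this sum (`exists_eq_sum`). Shapiro's lemma
(`shapiroInv_bijective`) and the bijectivity of $\delta$ for compact groups (`delta_injective`,
`delta_surjective`) turn the summands into $\mathrm{Br}(l)$, $\mathrm X(l)$ and the $\mathrm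
X(l(a_p))$. Uniqueness holds because these summands generate and the inverse Shapiro map is
injective.

In these terms $s^*$ is computed from $s(u)=c/u$ and $s(u-a)=-\sigma(a)\,(u-c/\sigma(a))/u$. It acts
on $\mathrm{Br}(l)$ as $\sigma$ and maps the summand at $p$ into those at $1$, $u$ and $\tilde p$.
Each linear factor contributes one $1/u$, so the order at $0$ of $s(\iota(x))$ is minus the degree
of $x$. On $H^2$ the degree is corestriction (`degMap_eq_delta_cor`), so the $u$-component of
$s^*(\beta,\chi_u,\chi)$ is $-\sigma\chi_u-\sigma\,\mathrm{Cor}\,\chi$ (`IsABF.sDec_u`).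

The other input is that $s^*$ is an involution: $s^2$ is the coefficient action of $\sigma^2\in
G_l$, and inner automorphisms act trivially on cohomology (`sStar_sStar`). Assertion 1 and the first
half of 3 follow by reading the $u$-component of $s^*s^*=1$. In the second half of 3 the hypotheses
say exactly that $s^*(0,\chi_u,\chi)=(s_1^*,\chi_u,\chi)$. Applying $s^*$ again gives $\sigma
s_1^*+s_1^*=0$. Assertion 2 compares conjugation by $\sigma$ with conjugation by $\sigma\tau$; the
two differ by an inner automorphism of $G_l$ (`shapiroInv_prP_sStar_iotaMap`). -/

theorem H2.exists_rep (x : H2 ρ) : ∃ f, H2.mk ρ f = x :=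
  QuotientAddGroup.mk'_surjective _ x

theorem H2.mk_eq_zero_iff {f : Z2 ρ} : H2.mk ρ f = 0 ↔
    ∃ b : G → M, IsLocallyConstant b ∧
      ∀ g₁ g₂, ρ g₁ (b g₂) - b (g₁ * g₂) + b g₁ = f.1 (g₁, g₂) := by
  refine (QuotientAddGroup.eq_zero_iff f).trans (AddSubgroup.mem_addSubgroupOf.trans ?_)
  constructor
  · rintro ⟨b, hb, h⟩
    exact ⟨b, hb, fun g₁ g₂ => congrFun h (g₁, g₂)⟩
  · rintro ⟨b, hb, h⟩
    exact ⟨b, hb, funext fun g => h g.1 g.2⟩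

theorem H2.mk_eq_mk_of {f f' : Z2 ρ} (b : G → M) (hb : IsLocallyConstant b)
    (h : ∀ g₁ g₂, ρ g₁ (b g₂) - b (g₁ * g₂) + b g₁ = f.1 (g₁, g₂) - f'.1 (g₁, g₂)) :
    H2.mk ρ f = H2.mk ρ f' := by
  rw [← sub_eq_zero, ← map_sub, H2.mk_eq_zero_iff]
  exact ⟨b, hb, h⟩

theorem H2.map_mk (φ : G' →* G) (hφ : Continuous φ) (ψ : M →+ M')
    (h : ∀ g m, ψ (ρ (φ g) m) = ρ' g (ψ m)) (f : Z2 ρ) :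
    H2.map φ hφ ψ h (H2.mk ρ f) = H2.mk ρ' (Z2.map φ hφ ψ h f) := rfl

theorem H2.map_eq_map {φ φ' : G' →* G} {hφ : Continuous φ} {hφ' : Continuous φ'} {ψ ψ' : M →+ M'}
    {h : ∀ g m, ψ (ρ (φ g) m) = ρ' g (ψ m)} {h' : ∀ g m, ψ' (ρ (φ' g) m) = ρ' g (ψ' m)}
    (h₁ : ∀ g, φ g = φ' g) (h₂ : ∀ m, ψ m = ψ' m) (x : H2 ρ) :
    H2.map φ hφ ψ h x = H2.map φ' hφ' ψ' h' x := by
  obtain rfl : φ = φ' := MonoidHom.ext h₁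
  obtain rfl : ψ = ψ' := AddMonoidHom.ext h₂
  rfl

theorem H2.map_map {φ : G' →* G} (hφ : Continuous φ) {ψ : M →+ M'}
    (h : ∀ g m, ψ (ρ (φ g) m) = ρ' g (ψ m)) {φ' : G'' →* G'} (hφ' : Continuous φ') {ψ' : M' →+ M''}
    (h' : ∀ g m, ψ' (ρ' (φ' g) m) = ρ'' g (ψ' m)) (x : H2 ρ) :
    H2.map φ' hφ' ψ' h' (H2.map φ hφ ψ h x) =
      H2.map (φ.comp φ') (hφ.comp hφ') (ψ'.comp ψ) (ρ' := ρ'')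
        (fun g m => by simp [h, h']) x := by
  obtain ⟨f, rfl⟩ := H2.exists_rep x
  rfl

theorem H2.map_eq_self {φ : G →* G} {hφ : Continuous φ} {ψ : M →+ M}
    {h : ∀ g m, ψ (ρ (φ g) m) = ρ g (ψ m)} (h₁ : ∀ g, φ g = g) (h₂ : ∀ m, ψ m = m) (x : H2 ρ) :
    H2.map φ hφ ψ h x = x := by
  obtain ⟨f, rfl⟩ := H2.exists_rep x
  rw [H2.map_mk]
  congr 1
  ext g
  simp [Z2.map, h₁, h₂]

theorem H2.map_eq_zero {φ : G' →* G} {hφ : Continuous φ} {ψ : M →+ M'}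
    {h : ∀ g m, ψ (ρ (φ g) m) = ρ' g (ψ m)} (h₂ : ∀ m, ψ m = 0) (x : H2 ρ) :
    H2.map φ hφ ψ h x = 0 := by
  obtain ⟨f, rfl⟩ := H2.exists_rep x
  rw [H2.map_mk, ← map_zero (H2.mk ρ')]
  congr 1
  ext g
  simp [Z2.map, h₂]

theorem H2.map_eq_neg {φ φ' : G' →* G} {hφ : Continuous φ} {hφ' : Continuous φ'} {ψ ψ' : M →+ M'}
    {h : ∀ g m, ψ (ρ (φ g) m) = ρ' g (ψ m)} {h' : ∀ g m, ψ' (ρ (φ' g) m) = ρ' g (ψ' m)}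
    (h₁ : ∀ g, φ g = φ' g) (h₂ : ∀ m, ψ m = -ψ' m) (x : H2 ρ) :
    H2.map φ hφ ψ h x = -H2.map φ' hφ' ψ' h' x := by
  obtain ⟨f, rfl⟩ := H2.exists_rep x
  rw [H2.map_mk, H2.map_mk, ← map_neg]
  congr 1
  ext g
  simp [Z2.map, h₁, h₂]

/-- Inner automorphisms act trivially on cohomology. -/
theorem H2.map_inner [ContinuousMul G] {φ : G →* G} {hφ : Continuous φ} {ψ : M →+ M}
    {h : ∀ g m, ψ (ρ (φ g) m) = ρ g (ψ m)} (τ : G) (h₁ : ∀ g, φ g = τ⁻¹ * g * τ)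
    (h₂ : ∀ m, ψ m = ρ τ m) (x : H2 ρ) : H2.map φ hφ ψ h x = x := by
  obtain ⟨f, rfl⟩ := H2.exists_rep x
  rw [H2.map_mk]
  -- The usual homotopy for conjugation. Its coboundary is the combination of the cocycle identities
  -- at $(\tau,g_1^\tau,g_2^\tau)$, $(g_1,\tau,g_2^\tau)$ and $(g_1,g_2,\tau)$, where
  -- $g^\tau=\tau^{-1}g\tau$.
  refine H2.mk_eq_mk_of (fun g => f.1 (τ, τ⁻¹ * g * τ) - f.1 (g, τ))
    ((f.2.1.comp_continuous (f := fun g : G => (τ, τ⁻¹ * g * τ)) (by fun_prop)).sub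
      (f.2.1.comp_continuous (f := fun g : G => (g, τ)) (by fun_prop))) fun g₁ g₂ => ?_
  have e₁ := f.2.2 τ (τ⁻¹ * g₁ * τ) (τ⁻¹ * g₂ * τ)
  have e₂ := f.2.2 g₁ τ (τ⁻¹ * g₂ * τ)
  have e₃ := f.2.2 g₁ g₂ τ
  have t₁ : ∀ g, τ * (τ⁻¹ * g * τ) = g * τ := fun g => by group
  have t₂ : τ⁻¹ * g₁ * τ * (τ⁻¹ * g₂ * τ) = τ⁻¹ * (g₁ * g₂) * τ := by group
  rw [t₁, t₂] at e₁
  rw [t₁] at e₂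
  simp only [Z2.map, AddMonoidHom.coe_mk, ZeroHom.coe_mk, h₁, h₂, map_sub]
  rw [← sub_eq_zero]
  have := congrArg₂ (· - ·) (congrArg₂ (· - ·) e₂ e₁) e₃
  simp only [sub_zero] at this
  rw [← this]
  abel

end Functoriality

/-! ## Compact groups -/

section Compact

variable {G : Type*} [Group G] [TopologicalSpace G]

/-- Two locally constant rational lifts of a character differ by an integral cochain, so $\delta$
may be computed from any of them, not only from `ratLift`. -/
theorem delta_eq_mk [ContinuousMul G] (χ : Chars G) (f : Z2 (1 : G →* AddMonoid.End ℤ)) (b : G → ℚ)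
    (hb : IsLocallyConstant b) (hχ : ∀ g, (b g : QZ) = χ.1 g)
    (hf : ∀ g₁ g₂, (f.1 (g₁, g₂) : ℚ) = b g₂ - b (g₁ * g₂) + b g₁) :
    delta χ = H2.mk _ f := by
  have hl : IsLocallyConstant (ratLift χ.1) := χ.2.1.comp Quotient.out
  have key : ∀ g, ((⌊ratLift χ.1 g - b g⌋ : ℤ) : ℚ) = ratLift χ.1 g - b g := fun g =>
    floor_eq_of_coe_eq_zero (by rw [QuotientAddGroup.mk_sub, coe_ratLift, hχ, sub_self])
  refine H2.mk_eq_mk_of (fun g => ⌊ratLift χ.1 g - b g⌋) ((hl.sub hb).comp Int.floor)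
    fun g₁ g₂ => ?_
  have inj : ∀ n m : ℤ, (n : ℚ) = m → n = m := fun n m hn => by exact_mod_cast hn
  apply inj
  simp only [MonoidHom.one_apply, AddMonoid.End.coe_one, id_eq]
  push_cast
  rw [key, key, key, hf, deltaFun_cast]
  ring

/-- This is $H^1(G,\mathbb Q)=0$: compactness makes the range finite, while a nonzero value would
have infinitely many distinct multiples. -/
theorem addHom_eq_zero_of_isLocallyConstant [CompactSpace G] (β : G → ℚ)
    (hβ : IsLocallyConstant β) (hadd : ∀ g h, β (g * h) = β g + β h) (g : G) : β g = 0 := by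
  by_contra hg
  have hpow : ∀ n : ℕ, β (g ^ n) = n * β g := by
    intro n
    induction n with
    | zero =>
      have := hadd 1 1
      rw [one_mul, left_eq_add] at this
      simpa using this
    | succ n ih => rw [pow_succ, hadd, ih]; push_cast; ring
  refine Set.infinite_range_of_injective (f := fun n : ℕ => β (g ^ n)) (fun m n h => ?_)
    (hβ.range_finite.subset ?_)
  · simp only [hpow] at h
    exact_mod_cast mul_right_cancel₀ hg h
  · rintro _ ⟨n, rfl⟩
    exact ⟨_, rfl⟩

/-- If $\delta\chi$ is the coboundary of an integral $b$, then a rational lift of $\chi$ minus $b$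
is a continuous homomorphism to $\mathbb Q$, hence zero, and so $\chi$ has integral lifts. -/
theorem delta_injective [ContinuousMul G] [CompactSpace G] :
    Function.Injective (delta : Chars G →+ _) := by
  rw [injective_iff_map_eq_zero]
  intro χ h
  obtain ⟨b, hb, h⟩ := H2.mk_eq_zero_iff.1 h
  have hl : IsLocallyConstant (ratLift χ.1) := χ.2.1.comp Quotient.out
  have hb' : IsLocallyConstant (fun g => (b g : ℚ)) := hb.comp _
  have key := addHom_eq_zero_of_isLocallyConstant _ (hl.sub hb') fun g₁ g₂ => by
    have h1 := deltaFun_cast χ (g₁, g₂)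
    have h2 : (b g₂ - b (g₁ * g₂) + b g₁ : ℤ) = deltaFun χ.1 (g₁, g₂) := h g₁ g₂
    rw [← h2] at h1
    push_cast at h1
    simp only [Pi.sub_apply]
    linarith
  ext g
  have := key g
  simp only [Pi.sub_apply, sub_eq_zero] at this
  rw [← coe_ratLift χ.1 g, this]
  exact (QuotientAddGroup.eq_zero_iff _).2 (AddSubgroup.mem_zmultiples_iff.2 ⟨b g, by simp⟩)

/-- The right translations that do not change a function on `X × G`. -/
def rightStabilizer {X M : Type*} (f : X × G → M) : Subgroup G where
  carrier := {u | ∀ x g, f (x, g * u) = f (x, g)}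
  one_mem' := by simp
  mul_mem' {u v} hu hv x g := by rw [← mul_assoc, hv, hu]
  inv_mem' {u} hu x g := by rw [← hu, inv_mul_cancel_right]

/-- The complement is the projection of a closed set along the compact space $X\times G$, hence
closed. -/
theorem isOpen_rightStabilizer [IsTopologicalGroup G] [CompactSpace G] {X M : Type*}
    [TopologicalSpace X] [CompactSpace X] {f : X × G → M} (hf : IsLocallyConstant f) :
    IsOpen (rightStabilizer f : Set G) := by
  have hW : IsOpen {q : (X × G) × G | f (q.1.1, q.1.2 * q.2) = f q.1} :=
    ((hf.comp_continuous (f := fun q : (X × G) × G => (q.1.1, q.1.2 * q.2)) (by fun_prop)).prodMk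
      (hf.comp_continuous (f := fun q : (X × G) × G => q.1) (by fun_prop))) {q | q.1 = q.2}
  rw [← isClosed_compl_iff]
  convert! isClosedMap_snd_of_compactSpace _ hW.isClosed_compl using 1
  ext u
  simp [rightStabilizer]

/-- This is $H^2(G,\mathbb Q)=0$. The cocycle factors, in its second variable, through a finite
coset space $G/U$; averaging over that variable gives the bounding cochain. -/
theorem exists_rat_cochain [IsTopologicalGroup G] [CompactSpace G] (f : G × G → ℚ)
    (hf : IsLocallyConstant f)
    (h : ∀ g₁ g₂ g₃, f (g₂, g₃) - f (g₁ * g₂, g₃) + f (g₁, g₂ * g₃) - f (g₁, g₂) = 0) :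
    ∃ b : G → ℚ, IsLocallyConstant b ∧ ∀ g₁ g₂, f (g₁, g₂) = b g₂ - b (g₁ * g₂) + b g₁ := by
  classical
  let U := rightStabilizer f
  have hU : IsOpen (U : Set G) := isOpen_rightStabilizer hf
  have : Finite (G ⧸ U) := Subgroup.quotient_finite_of_isOpen U hU
  have := Fintype.ofFinite (G ⧸ U)
  let F : G → G ⧸ U → ℚ := fun g => Quotient.lift (fun x => f (g, x)) fun x y hxy => by
    have hxy : x⁻¹ * y ∈ U := QuotientGroup.leftRel_apply.1 hxy
    rw [← hxy g x, mul_inv_cancel_left]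
  have hF : ∀ g x, F g (x : G) = f (g, x) := fun _ _ => rfl
  have hn : (Fintype.card (G ⧸ U) : ℚ) ≠ 0 := by
    exact_mod_cast Fintype.card_ne_zero
  refine ⟨fun g => (∑ q, F g q) / Fintype.card (G ⧸ U), ?_, fun g₁ g₂ => ?_⟩
  · have : IsLocallyConstant F := by
      have h1 : ∀ q : G ⧸ U, IsLocallyConstant fun g => F g q := by
        intro q
        induction q using QuotientGroup.induction_on with
        | H x => exact hf.comp_continuous (f := fun g => (g, x)) (by fun_prop)
      rw [IsLocallyConstant.iff_eventually_eq]
      intro g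
      have := Filter.eventually_all.2 fun q => (h1 q).eventually_eq g
      filter_upwards [this] with y hy using funext hy
    exact this.comp fun v => (∑ q, v q) / Fintype.card (G ⧸ U)
  · have h1 : ∀ q : G ⧸ U, f (g₁, g₂) = F g₂ q - F (g₁ * g₂) q + F g₁ (g₂ • q) := by
      intro q
      induction q using QuotientGroup.induction_on with
      | H x =>
        have := h g₁ g₂ x
        rw [MulAction.Quotient.smul_coe, hF, hF, hF, smul_eq_mul]
        linarith
    have h2 : ∑ q, F g₁ (g₂ • q) = ∑ q, F g₁ q :=
      Equiv.sum_comp (MulAction.toPerm g₂ : Equiv.Perm (G ⧸ U)) (F g₁)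
    have h3 : Fintype.card (G ⧸ U) * f (g₁, g₂) =
        ∑ q, F g₂ q - ∑ q, F (g₁ * g₂) q + ∑ q, F g₁ q := by
      rw [← h2, ← Finset.sum_sub_distrib, ← Finset.sum_add_distrib,
        ← Finset.sum_congr rfl fun q _ => h1 q]
      simp
    field_simp
    linarith

/-- An integral cocycle bounds a rational cochain; as its coboundary is integral, that cochain is a
character modulo $\mathbb Z$. -/
theorem delta_surjective [IsTopologicalGroup G] [CompactSpace G] :
    Function.Surjective (delta : Chars G →+ _) := by
  intro x
  obtain ⟨f, rfl⟩ := H2.exists_rep x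
  obtain ⟨b, hb, h⟩ := exists_rat_cochain (fun g => (f.1 g : ℚ)) (f.2.1.comp _) fun g₁ g₂ g₃ => by
    have := f.2.2 g₁ g₂ g₃
    simp only [MonoidHom.one_apply, AddMonoid.End.coe_one, id_eq] at this
    exact_mod_cast this
  refine ⟨⟨fun g => (b g : QZ), hb.comp _, fun g₁ g₂ => ?_⟩, delta_eq_mk _ f b hb (fun _ => rfl) h⟩
  have := h g₁ g₂
  have h2 : b g₁ + b g₂ - b (g₁ * g₂) = (f.1 (g₁, g₂) : ℚ) := by rw [this]; ring
  rw [← QuotientAddGroup.mk_add, eq_comm, ← sub_eq_zero, ← QuotientAddGroup.mk_sub, h2,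
    QuotientAddGroup.eq_zero_iff]
  exact AddSubgroup.mem_zmultiples_iff.2 ⟨f.1 (g₁, g₂), by simp⟩

end Compact

/-! ## Shapiro's lemma in degree two -/

section Shapiro

variable {Γ : Type*} [Group Γ] {H G : Subgroup Γ}

/-- Values at representatives of `G / H` determine functions that are left invariant under `H`. -/
theorem apply_out_inv {M : Type*} {φ : G → M} (hφ : ∀ h g : G, (h : Γ) ∈ H → φ (h * g) = φ g)
    (g : G) : φ ((g⁻¹ : G) : G ⧸ H.subgroupOf G).out⁻¹ = φ g := by
  obtain ⟨h, hh⟩ := QuotientGroup.mk_out_eq_mul (H.subgroupOf G) g⁻¹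
  rw [hh, mul_inv_rev, inv_inv]
  exact hφ _ _ (inv_mem h.2)

/-- Right translation by $g$ permutes the cosets $H\backslash G$, here indexed by inverses of
representatives of $G/H$. -/
theorem finsum_out_inv_mul {M : Type*} [AddCommMonoid M] {φ : G → M}
    (hφ : ∀ h g : G, (h : Γ) ∈ H → φ (h * g) = φ g) (g : G) :
    ∑ᶠ q : G ⧸ H.subgroupOf G, φ (q.out⁻¹ * g) = ∑ᶠ q : G ⧸ H.subgroupOf G, φ q.out⁻¹ := by
  refine (finsum_congr fun q => ?_).trans (finsum_comp_equiv (f := fun q => φ q.out⁻¹)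
    (MulAction.toPerm g⁻¹ : Equiv.Perm (G ⧸ H.subgroupOf G)))
  rw [← apply_out_inv hφ, mul_inv_rev, inv_inv]
  congr 3
  conv_rhs => rw [← QuotientGroup.out_eq' q]
  rfl

/-- The degree `A → ℤ`, `x ↦ ∑_{τ H ∈ G / H} x(τ⁻¹)`. -/
def deg (H G : Subgroup Γ) [(H.subgroupOf G).FiniteIndex] : Ind H G →+ ℤ where
  toFun x := ∑ᶠ q : G ⧸ H.subgroupOf G, x.1 q.out⁻¹
  map_zero' := finsum_zero
  map_add' _ _ := finsum_add_distrib (Set.toFinite _) (Set.toFinite _)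

theorem deg_indRep [(H.subgroupOf G).FiniteIndex] (g : G) (x : Ind H G) :
    deg H G (indRep H G g x) = (1 : G →* AddMonoid.End ℤ) g (deg H G x) :=
  finsum_out_inv_mul x.2 g

/-- An element of the induced module is determined by its values at finitely many representatives,
so pointwise local constancy is uniform. -/
theorem isLocallyConstant_ind [(H.subgroupOf G).FiniteIndex] {X : Type*} [TopologicalSpace X]
    {F : X → Ind H G} (h : ∀ g, IsLocallyConstant fun x => (F x).1 g) : IsLocallyConstant F := by
  rw [IsLocallyConstant.iff_eventually_eq]
  intro x
  have := Filter.eventually_all.2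
    fun q : G ⧸ H.subgroupOf G => (h q.out⁻¹).eventually_eq x
  filter_upwards [this] with y hy
  ext g
  rw [← apply_out_inv (F y).2, hy, apply_out_inv (F x).2]

variable [TopologicalSpace Γ]

/-- A continuous retraction `G → H` commuting with left translations by `H`. -/
structure LeftRetraction (H G : Subgroup Γ) (hle : H ≤ G) where
  toFun : G → H
  cont : Continuous toFun
  map_one : toFun 1 = 1
  map_mul : ∀ h g, toFun (Subgroup.inclusion hle h * g) = h * toFun g

namespace LeftRetraction

variable {hle : H ≤ G} (r : LeftRetraction H G hle)

/-- The crossed homomorphism `(x, g) ↦ r(x)⁻¹ r(x g)` attached to a retraction `r`. -/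
def cross (x g : G) : H := (r.toFun x)⁻¹ * r.toFun (x * g)

theorem map_coe (h : H) : r.toFun (Subgroup.inclusion hle h) = h := by
  simpa [r.map_one] using r.map_mul h 1

theorem cross_mul (x g₁ g₂ : G) : r.cross x (g₁ * g₂) = r.cross x g₁ * r.cross (x * g₁) g₂ := by
  simp [cross, mul_assoc]

theorem map_mul_of_mem (h g : G) (hh : (h : Γ) ∈ H) : r.toFun (h * g) = ⟨h, hh⟩ * r.toFun g :=
  r.map_mul ⟨h, hh⟩ g

theorem cross_mul_left (h x g : G) (hh : (h : Γ) ∈ H) : r.cross (h * x) g = r.cross x g := by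
  simp [cross, mul_assoc, r.map_mul_of_mem h _ hh]

theorem cross_one_coe (h : H) : r.cross 1 (Subgroup.inclusion hle h) = h := by
  simp [cross, r.map_one, r.map_coe]

variable [IsTopologicalGroup Γ]

theorem continuous_cross {X : Type*} [TopologicalSpace X] (x : G) {g : X → G} (hg : Continuous g) :
    Continuous fun y => r.cross x (g y) :=
  continuous_const.mul (r.cont.comp (continuous_const.mul hg))

theorem continuous_cross' {X : Type*} [TopologicalSpace X] {x g : X → G} (hx : Continuous x)
    (hg : Continuous g) : Continuous fun y => r.cross (x y) (g y) :=
  (r.cont.comp hx).inv.mul (r.cont.comp (hx.mul hg))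

variable [(H.subgroupOf G).FiniteIndex]

/-- The Shapiro isomorphism on cocycles. -/
def indCocycle (z : Z2 (1 : H →* AddMonoid.End ℤ)) : Z2 (indRep H G) :=
  ⟨fun g => ⟨fun x => z.1 (r.cross x g.1, r.cross (x * g.1) g.2), fun h x hh => by
      simp only [mul_assoc, r.cross_mul_left h _ _ hh]⟩,
    isLocallyConstant_ind fun x => z.2.1.comp_continuous
      (f := fun g : G × G => (r.cross x g.1, r.cross (x * g.1) g.2))
      ((r.continuous_cross x continuous_fst).prodMk
        (r.continuous_cross' (by fun_prop) continuous_snd)),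
    fun g₁ g₂ g₃ => by
      ext x
      have := z.2.2 (r.cross x g₁) (r.cross (x * g₁) g₂) (r.cross (x * g₁ * g₂) g₃)
      show z.1 (r.cross (x * g₁) g₂, r.cross (x * g₁ * g₂) g₃) -
        z.1 (r.cross x (g₁ * g₂), r.cross (x * (g₁ * g₂)) g₃) +
        z.1 (r.cross x g₁, r.cross (x * g₁) (g₂ * g₃)) -
        z.1 (r.cross x g₁, r.cross (x * g₁) g₂) = 0
      rw [r.cross_mul, r.cross_mul _ g₂, ← mul_assoc]
      exact this⟩

/-- The retraction is the identity on $H$, so at $x=1$ the crossed homomorphism restricts to the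
identity of $H$ and the cocycle comes back unchanged. -/
theorem shapiroInv_indCocycle (z : Z2 (1 : H →* AddMonoid.End ℤ)) :
    shapiroInv H G hle (H2.mk _ (r.indCocycle z)) = H2.mk _ z := by
  refine (H2.map_mk _ _ _ _ _).trans (congrArg _ ?_)
  ext ⟨h₁, h₂⟩
  show z.1 (r.cross 1 (Subgroup.inclusion hle h₁),
    r.cross (1 * Subgroup.inclusion hle h₁) (Subgroup.inclusion hle h₂)) = z.1 (h₁, h₂)
  rw [one_mul, r.cross_one_coe, ← mul_one (Subgroup.inclusion hle h₁),
    r.cross_mul_left _ _ _ h₁.2, r.cross_one_coe]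

-- In homogeneous form $f$ becomes an $H$-invariant cocycle $F$ on $G$. The retraction is an $H$-map
-- $G\to H\subseteq G$, so the prism homotopy makes $F$ cohomologous to its pullback along the
-- retraction, and that pullback is bounded by $\beta$.
include r in
theorem shapiroInv_injective : Function.Injective (shapiroInv H G hle) := by
  rw [injective_iff_map_eq_zero]
  intro y hy
  obtain ⟨f, rfl⟩ := H2.exists_rep y
  obtain ⟨β, hβ, h⟩ := H2.mk_eq_zero_iff.1 hy
  have h : ∀ h₁ h₂ : H, β h₂ - β (h₁ * h₂) + β h₁ =
    (f.1 (Subgroup.inclusion hle h₁, Subgroup.inclusion hle h₂)).1 1 := h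
  have hf : ∀ g₁ g₂ g₃ x : G, (f.1 (g₂, g₃)).1 (x * g₁) - (f.1 (g₁ * g₂, g₃)).1 x +
      (f.1 (g₁, g₂ * g₃)).1 x - (f.1 (g₁, g₂)).1 x = 0 := fun g₁ g₂ g₃ x =>
    congrFun (congrArg Subtype.val (f.2.2 g₁ g₂ g₃)) x
  let ι := Subgroup.inclusion hle
  -- The homogeneous cochain, with evaluation at the first vertex absorbing the action on the
  -- induced module.
  let F : G → G → G → ℤ := fun a b c => (f.1 (a⁻¹ * b, b⁻¹ * c)).1 a
  have hF : ∀ a b c d, F b c d - F a c d + F a b d - F a b c = 0 := by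
    intro a b c d
    have := hf (a⁻¹ * b) (b⁻¹ * c) (c⁻¹ * d) a
    simp only [mul_assoc, mul_inv_cancel_left] at this
    exact this
  have hFh : ∀ h a b c : G, (h : Γ) ∈ H → F (h * a) (h * b) (h * c) = F a b c := by
    intro h a b c hh
    simp only [F, mul_inv_rev, mul_assoc, inv_mul_cancel_left]
    exact (f.1 _).2 h a hh
  have hFβ : ∀ a b c : H, F (ι a) (ι b) (ι c) =
      β (b⁻¹ * c) - β (a⁻¹ * c) + β (a⁻¹ * b) := by
    intro a b c
    have h1 := h (a⁻¹ * b) (b⁻¹ * c)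
    rw [mul_assoc, mul_inv_cancel_left] at h1
    rw [h1]
    have := (f.1 (ι (a⁻¹ * b), ι (b⁻¹ * c))).2 (ι a) 1 a.2
    rw [mul_one] at this
    rw [← this]
    rfl
  let R : G → G := fun g => ι (r.toFun g)
  have hR : Continuous R := (continuous_inclusion hle).comp r.cont
  have hRh : ∀ h g : G, (h : Γ) ∈ H → R (h * g) = h * R g := by
    intro h g hh
    simp only [R, ι, r.map_mul_of_mem h g hh]
    rfl
  -- The first two terms are the prism between the edge $(a,b)$ and its image $(Ra,Rb)$; the last is
  -- the homogeneous form of $\beta$ on that image. The sought cochain sends $g$ to $x\mapsto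
  -- P(x,xg)$.
  let P : G → G → ℤ := fun a b =>
    F a b (R b) - F a (R a) (R b) + β ((r.toFun a)⁻¹ * r.toFun b)
  have hFc : ∀ (a : G) (u v : G → G), Continuous u → Continuous v →
      IsLocallyConstant fun g => F a (u g) (v g) := fun a u v hu hv =>
    (f.2.1.comp_continuous (f := fun g => (a⁻¹ * u g, (u g)⁻¹ * v g)) (by fun_prop)).comp
      fun m => m.1 a
  refine H2.mk_eq_zero_iff.2 ⟨fun g => ⟨fun x => P x (x * g), fun h x hh => ?_⟩,
    isLocallyConstant_ind fun x => ?_, fun g₁ g₂ => ?_⟩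
  · simp only [P, mul_assoc, hRh h _ hh, hFh h _ _ _ hh, r.map_mul_of_mem h _ hh, mul_inv_rev,
      inv_mul_cancel_left]
  · have hm : Continuous fun g => x * g := continuous_const.mul continuous_id
    exact ((hFc x _ _ hm (hR.comp hm)).sub (hFc x _ _ continuous_const (hR.comp hm))).add
      (hβ.comp_continuous (f := fun g => (r.toFun x)⁻¹ * r.toFun (x * g))
        (continuous_const.mul (r.cont.comp hm)))
  · ext x
    show P (x * g₁) (x * g₁ * g₂) - P x (x * (g₁ * g₂)) + P x (x * g₁) = (f.1 (g₁, g₂)).1 x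
    have h0 : (f.1 (g₁, g₂)).1 x = F x (x * g₁) (x * g₁ * g₂) := by
      simp [F, mul_assoc]
    rw [h0, ← mul_assoc]
    generalize x * g₁ * g₂ = c
    generalize x * g₁ = b
    have e₁ := hF x b c (R c)
    have e₂ := hF x b (R b) (R c)
    have e₃ := hF x (R x) (R b) (R c)
    have e₄ := hFβ (r.toFun x) (r.toFun b) (r.toFun c)
    simp only [P]
    simp only [R, ι] at *
    linarith

end LeftRetraction

/-- Evaluation at `1` on the induced module. -/
def evalOne (H G : Subgroup Γ) : Ind H G →+ ℤ where
  toFun x := x.1 1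
  map_zero' := rfl
  map_add' _ _ := rfl

theorem continuous_subgroup_inclusion (hle : H ≤ G) : Continuous (Subgroup.inclusion hle) :=
  continuous_inclusion hle

theorem evalOne_indRep (hle : H ≤ G) (g : H) (x : Ind H G) :
    evalOne H G (indRep H G (Subgroup.inclusion hle g) x) =
      (1 : H →* AddMonoid.End ℤ) g (evalOne H G x) := by
  have := x.2 (Subgroup.inclusion hle g) 1 g.2
  rw [mul_one] at this
  show x.1 (1 * Subgroup.inclusion hle g) = x.1 1
  rwa [one_mul]

theorem shapiroInv_eq_map (hle : H ≤ G) (y : H2 (indRep H G)) : shapiroInv H G hle y =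
    H2.map (Subgroup.inclusion hle) (continuous_subgroup_inclusion hle) (evalOne H G)
      (evalOne_indRep hle) y := rfl

variable [IsTopologicalGroup Γ]

/-- Take $r(x)=x\,t$ with $t$ the representative of $x^{-1}H$ in a transversal. It is continuous
because $H$ is open, and at inverses of the chosen representatives its crossed homomorphism yields
the very terms of the transfer. Hence the same $r$ serves both Shapiro and corestriction. -/
theorem exists_leftRetraction (hle : H ≤ G) [(H.subgroupOf G).FiniteIndex]
    (hH : IsOpen (H : Set Γ)) : ∃ r : LeftRetraction H G hle, ∀ (χ : Chars H) (g : G),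
      (cor H G hH χ).1 g = ∑ᶠ q : G ⧸ H.subgroupOf G, χ.1 (r.cross q.out⁻¹ g) := by
  -- The transversal must contain $1$ in order that $r(1)=1$.
  obtain ⟨S, hS, h1⟩ := (H.subgroupOf G).exists_isComplement_left 1
  let T : (H.subgroupOf G).LeftTransversal := ⟨S, hS⟩
  let α := T.2.leftQuotientEquiv
  have hα : ∀ q, ((α q : G) : G ⧸ H.subgroupOf G) = q := T.2.leftQuotientEquiv.symm_apply_apply
  have hα1 : (α (1 : G) : G) = 1 :=
    congrArg Subtype.val (T.2.leftQuotientEquiv.apply_symm_apply ⟨1, h1⟩)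
  have hmem : ∀ x : G, ((x * (α (x⁻¹ : G) : G) : G) : Γ) ∈ H := by
    intro x
    have := QuotientGroup.eq.1 (hα (x⁻¹ : G)).symm
    rw [inv_inv, Subgroup.mem_subgroupOf] at this
    exact this
  have hαh : ∀ h g : G, (h : Γ) ∈ H → α ((h * g)⁻¹ : G) = α (g⁻¹ : G) := by
    intro h g hh
    congr 1
    rw [mul_inv_rev, QuotientGroup.eq, Subgroup.mem_subgroupOf]
    simpa using hh
  have hloc : IsLocallyConstant fun g : G => (α (g⁻¹ : G) : G) := by
    rw [IsLocallyConstant.iff_eventually_eq]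
    intro g
    have hopen : IsOpen {g' : G | ((g' * g⁻¹ : G) : Γ) ∈ H} :=
      hH.preimage (continuous_subtype_val.comp (by fun_prop))
    filter_upwards [hopen.mem_nhds (show ((g * g⁻¹ : G) : Γ) ∈ H by simp)] with g' hg'
    rw [← hαh _ g hg', inv_mul_cancel_right]
  let r : LeftRetraction H G hle :=
    { toFun := fun x => ⟨_, hmem x⟩
      cont := Continuous.subtype_mk (continuous_subtype_val.comp
        (continuous_id.mul hloc.continuous)) _
      map_one := by
        ext
        show (((1 : G) * (α ((1 : G)⁻¹ : G) : G) : G) : Γ) = 1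
        rw [inv_one, hα1, one_mul, Subgroup.coe_one]
      map_mul := fun h g => by
        ext
        show ((Subgroup.inclusion hle h * g * (α ((Subgroup.inclusion hle h * g)⁻¹ : G) : G) : G) : Γ)
          = h * ((g * (α (g⁻¹ : G) : G) : G) : Γ)
        rw [hαh _ _ h.2, mul_assoc]
        rfl }
  refine ⟨r, fun χ g => ?_⟩
  let _ := (H.subgroupOf G).fintypeQuotientOfFiniteIndex
  rw [finsum_eq_sum_of_fintype]
  show ((charHom H G χ).transfer g).toAdd = _
  rw [MonoidHom.transfer_def _ T, Subgroup.leftTransversals.diff, toAdd_prod]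
  refine Finset.sum_congr rfl fun q _ => ?_
  -- The crossed homomorphism is left $H$-invariant in its first variable, so `q.out` may be
  -- exchanged for the representative in the transversal, where $r$ takes the value $1$.
  have e1 : r.cross q.out⁻¹ g = r.cross (α q : G)⁻¹ g := by
    conv_lhs => rw [← hα q]
    conv_rhs => rw [← inv_inv (α q : G)]
    have := apply_out_inv (H := H) (φ := fun x => r.cross x g)
      (fun h x hh => r.cross_mul_left h x g hh) (α q : G)⁻¹
    rw [inv_inv] at this
    simpa using this
  have e2 : r.toFun (α q : G)⁻¹ = 1 := by
    ext
    show (((α q : G)⁻¹ * (α (((α q : G)⁻¹)⁻¹ : G) : G) : G) : Γ) = 1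
    rw [inv_inv, hα, inv_mul_cancel, Subgroup.coe_one]
  rw [e1]
  refine congrArg χ.1 ?_
  ext
  rw [LeftRetraction.cross, e2, inv_one, one_mul]
  show ((((α q : G))⁻¹ * (((g • T).2.leftQuotientEquiv q : G)) : G) : Γ) =
    (((α q : G)⁻¹ * g * (α (((α q : G)⁻¹ * g)⁻¹ : G) : G) : G) : Γ)
  have e3 : ((((α q : G)⁻¹ * g)⁻¹ : G) : G ⧸ H.subgroupOf G) = g⁻¹ • q := by
    rw [mul_inv_rev, inv_inv]
    conv_rhs => rw [← hα q]
    rfl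
  rw [Subgroup.smul_apply_eq_smul_apply_inv_smul, e3, smul_eq_mul, mul_assoc]

variable [(H.subgroupOf G).FiniteIndex]

theorem shapiroInv_bijective (hle : H ≤ G) (hH : IsOpen (H : Set Γ)) :
    Function.Bijective (shapiroInv H G hle) := by
  obtain ⟨r, -⟩ := exists_leftRetraction hle hH
  refine ⟨r.shapiroInv_injective, fun x => ?_⟩
  obtain ⟨z, rfl⟩ := H2.exists_rep x
  exact ⟨_, r.shapiroInv_indCocycle z⟩

/-- The map `H²(G, A) → H²(G, ℤ)` induced by the degree. -/
def degMap (H G : Subgroup Γ) [(H.subgroupOf G).FiniteIndex] :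
    H2 (indRep H G) →+ H2 (1 : G →* AddMonoid.End ℤ) :=
  H2.map (MonoidHom.id _) continuous_id (deg H G) deg_indRep

/-- Under Shapiro's isomorphism and the connecting maps the degree is the corestriction. -/
theorem degMap_eq_delta_cor (hle : H ≤ G) (hH : IsOpen (H : Set Γ)) (χ : Chars H)
    (y : H2 (indRep H G)) (hy : shapiroInv H G hle y = delta χ) :
    degMap H G y = delta (cor H G hH χ) := by
  obtain ⟨r, hr⟩ := exists_leftRetraction hle hH
  obtain ⟨z, hz, hδ⟩ : ∃ z : Z2 (1 : H →* AddMonoid.End ℤ), z.1 = deltaFun χ.1 ∧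
    delta χ = H2.mk _ z := ⟨_, rfl, rfl⟩
  have hl : IsLocallyConstant (ratLift χ.1) := χ.2.1.comp Quotient.out
  obtain rfl : y = H2.mk _ (r.indCocycle z) := r.shapiroInv_injective <| by
    rw [hy, r.shapiroInv_indCocycle, hδ]
  refine Eq.trans (H2.map_mk _ _ _ _ _) (Eq.symm ?_)
  let _ := (H.subgroupOf G).fintypeQuotientOfFiniteIndex
  -- Summing the rational lift of $\chi$ along the transfer formula gives a rational lift of
  -- $\mathrm{Cor}\,\chi$. It is generally not its `ratLift`, hence the use of an arbitrary lift.
  refine delta_eq_mk _ _ (fun g => ∑ᶠ q : G ⧸ H.subgroupOf G, ratLift χ.1 (r.cross q.out⁻¹ g))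
    ?_ ?_ ?_
  · have h1 : IsLocallyConstant fun (g : G) (q : G ⧸ H.subgroupOf G) =>
        ratLift χ.1 (r.cross q.out⁻¹ g) := by
      rw [IsLocallyConstant.iff_eventually_eq]
      intro g
      have := Filter.eventually_all.2 fun q : G ⧸ H.subgroupOf G =>
        (hl.comp_continuous (r.continuous_cross q.out⁻¹ continuous_id)).eventually_eq g
      filter_upwards [this] with y hy using funext hy
    exact h1.comp fun v => ∑ᶠ q, v q
  · intro g
    rw [hr, finsum_eq_sum_of_fintype, finsum_eq_sum_of_fintype, QuotientAddGroup.mk_sum]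
    simp only [coe_ratLift]
  · intro g₁ g₂
    have h2 := finsum_out_inv_mul (H := H) (φ := fun x => ratLift χ.1 (r.cross x g₂))
      (fun h x hh => by rw [r.cross_mul_left h x g₂ hh]) g₁
    show (((∑ᶠ q : G ⧸ H.subgroupOf G,
      z.1 (r.cross q.out⁻¹ g₁, r.cross (q.out⁻¹ * g₁) g₂) : ℤ)) : ℚ) = _
    rw [← h2]
    simp only [finsum_eq_sum_of_fintype, hz]
    push_cast
    rw [← Finset.sum_sub_distrib, ← Finset.sum_add_distrib]
    refine Finset.sum_congr rfl fun q _ => ?_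
    rw [deltaFun_cast, r.cross_mul]

end Shapiro

/-! ## Units of the field of rational functions -/

section Units

variable {K : Type*} [Field K]

/-- The leading coefficient of a rational function. -/
def leadHom (K : Type*) [Field K] : RatFunc K →* K where
  toFun R := R.num.leadingCoeff
  map_one' := by simp
  map_mul' R S := by
    -- Denominators are normalized to be monic, so only the numerators contribute.
    have h := congrArg Polynomial.leadingCoeff (RatFunc.num_denom_mul R S)
    simpa [Polynomial.leadingCoeff_mul, (RatFunc.monic_denom _).leadingCoeff] using h

/-- The leading coefficient on units, written additively. -/
def lead (K : Type*) [Field K] : Additive (RatFunc K)ˣ →+ Additive Kˣ :=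
  MonoidHom.toAdditive (Units.map (leadHom K))

/-- The order of a rational function at `a`. -/
def ordAt (a : K) : Additive (RatFunc K)ˣ →+ ℤ :=
  AddMonoidHom.mk' (fun R => ((R.toMul : RatFunc K).num.rootMultiplicity a : ℤ) -
    (R.toMul : RatFunc K).denom.rootMultiplicity a) <| by
    intro R S
    have hR := RatFunc.num_ne_zero R.toMul.ne_zero
    have hS := RatFunc.num_ne_zero S.toMul.ne_zero
    have hRS := RatFunc.num_ne_zero (R + S).toMul.ne_zero
    have dR := RatFunc.denom_ne_zero (R.toMul : RatFunc K)
    have dS := RatFunc.denom_ne_zero (S.toMul : RatFunc K)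
    have dRS := RatFunc.denom_ne_zero ((R + S).toMul : RatFunc K)
    have h := congrArg (Polynomial.rootMultiplicity a)
      (RatFunc.num_denom_mul (R.toMul : RatFunc K) S.toMul)
    have e : (R.toMul : RatFunc K) * S.toMul = ((R + S).toMul : RatFunc K) := rfl
    rw [e, Polynomial.rootMultiplicity_mul (mul_ne_zero hRS (mul_ne_zero dR dS)),
      Polynomial.rootMultiplicity_mul (mul_ne_zero dR dS),
      Polynomial.rootMultiplicity_mul (mul_ne_zero (mul_ne_zero hR hS) dRS),
      Polynomial.rootMultiplicity_mul (mul_ne_zero hR hS)] at h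
    omega

/-- Nonzero constants as units of `K(u)`. -/
def constUnit (K : Type*) [Field K] : Additive Kˣ →+ Additive (RatFunc K)ˣ :=
  MonoidHom.toAdditive (Units.map (RatFunc.C : K →+* RatFunc K).toMonoidHom)

/-- The unit `u - a`, written additively. -/
def lin (a : K) : Additive (RatFunc K)ˣ := Additive.ofMul (Datum.linUnit a)

theorem coe_toMul_constUnit (a : Additive Kˣ) :
    ((constUnit K a).toMul : RatFunc K) = RatFunc.C (a.toMul : K) := rfl

theorem coe_toMul_lin (a : K) : ((lin a).toMul : RatFunc K) = RatFunc.X - RatFunc.C a := rfl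

theorem coe_toMul_lin' (a : K) : ((lin a).toMul : RatFunc K) =
    algebraMap K[X] (RatFunc K) (Polynomial.X - Polynomial.C a) := by
  rw [coe_toMul_lin, map_sub, RatFunc.algebraMap_X, RatFunc.algebraMap_C]

theorem lin_zero : lin (0 : K) = Additive.ofMul (Datum.uUnit K) := by
  apply Additive.toMul.injective
  ext
  simp [coe_toMul_lin, Datum.uUnit]

theorem lead_constUnit (a : Additive Kˣ) : lead K (constUnit K a) = a := by
  apply Additive.toMul.injective
  ext
  show (RatFunc.C (a.toMul : K)).num.leadingCoeff = _
  simp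

theorem lead_lin (a : K) : lead K (lin a) = 0 := by
  apply Additive.toMul.injective
  ext
  show ((lin a).toMul : RatFunc K).num.leadingCoeff = 1
  rw [coe_toMul_lin', RatFunc.num_algebraMap, Polynomial.leadingCoeff_X_sub_C]

theorem ordAt_constUnit (b : K) (a : Additive Kˣ) : ordAt b (constUnit K a) = 0 := by
  show ((((constUnit K a).toMul : RatFunc K).num.rootMultiplicity b : ℤ) -
    ((constUnit K a).toMul : RatFunc K).denom.rootMultiplicity b) = 0
  rw [coe_toMul_constUnit, RatFunc.num_C, RatFunc.denom_C, Polynomial.rootMultiplicity_C,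
    ← Polynomial.C_1, Polynomial.rootMultiplicity_C, sub_self]

theorem ordAt_lin_self (a : K) : ordAt a (lin a) = 1 := by
  classical
  show ((((lin a).toMul : RatFunc K).num.rootMultiplicity a : ℤ) -
    ((lin a).toMul : RatFunc K).denom.rootMultiplicity a) = 1
  rw [coe_toMul_lin', RatFunc.num_algebraMap, RatFunc.denom_algebraMap, ← Polynomial.C_1,
    Polynomial.rootMultiplicity_C, Polynomial.rootMultiplicity_X_sub_C, if_pos rfl]
  simp

theorem ordAt_lin_of_ne {a b : K} (h : b ≠ a) : ordAt b (lin a) = 0 := by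
  classical
  show ((((lin a).toMul : RatFunc K).num.rootMultiplicity b : ℤ) -
    ((lin a).toMul : RatFunc K).denom.rootMultiplicity b) = 0
  rw [coe_toMul_lin', RatFunc.num_algebraMap, RatFunc.denom_algebraMap, ← Polynomial.C_1,
    Polynomial.rootMultiplicity_C, Polynomial.rootMultiplicity_X_sub_C, if_neg h]
  simp

/-- Over an algebraically closed field, the units of `K(u)` are generated by the constants and
the `u - a`. -/
theorem unit_induction [IsAlgClosed K] {P : Additive (RatFunc K)ˣ → Prop}
    (hC : ∀ a, P (constUnit K a)) (hL : ∀ a, P (lin a)) (hadd : ∀ R S, P R → P S → P (R + S))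
    (hneg : ∀ R, P R → P (-R)) (R : Additive (RatFunc K)ˣ) : P R := by
  have hs : ∀ s : Multiset K, P (s.map lin).sum ∧
      (((s.map lin).sum).toMul : RatFunc K) = algebraMap K[X] (RatFunc K)
        (s.map fun a => Polynomial.X - Polynomial.C a).prod := by
    intro s
    induction s using Multiset.induction with
    | empty =>
      refine ⟨?_, by simp⟩
      have := hC 0
      rw [map_zero] at this
      simpa using this
    | cons a s ih =>
      simp only [Multiset.map_cons, Multiset.sum_cons, Multiset.prod_cons]
      refine ⟨hadd _ _ (hL a) ih.1, ?_⟩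
      rw [toMul_add, Units.val_mul, coe_toMul_lin', ih.2, map_mul]
  have hp : ∀ p : K[X], p ≠ 0 →
      ∃ S, P S ∧ (S.toMul : RatFunc K) = algebraMap K[X] (RatFunc K) p := by
    intro p hp
    refine ⟨constUnit K (Additive.ofMul (Units.mk0 _ (Polynomial.leadingCoeff_ne_zero.2 hp))) +
      (p.roots.map lin).sum, hadd _ _ (hC _) (hs _).1, ?_⟩
    rw [toMul_add, Units.val_mul, coe_toMul_constUnit, (hs _).2]
    conv_rhs => rw [(IsAlgClosed.splits p).eq_prod_roots]
    rw [map_mul, RatFunc.algebraMap_C]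
    rfl
  obtain ⟨S, hS, hS'⟩ := hp _ (RatFunc.num_ne_zero R.toMul.ne_zero)
  obtain ⟨T, hT, hT'⟩ := hp _ (RatFunc.denom_ne_zero (R.toMul : RatFunc K))
  have : R = S + -T := by
    apply Additive.toMul.injective
    ext
    rw [toMul_add, toMul_neg, Units.val_mul, Units.val_inv_eq_inv_val, hS', hT', ← div_eq_mul_inv,
      RatFunc.num_div_denom]
  rw [this]
  exact hadd _ _ hS (hneg _ hT)

theorem unit_hom_ext [IsAlgClosed K] {A : Type*} [AddCommGroup A]
    {f g : Additive (RatFunc K)ˣ →+ A} (hC : ∀ a, f (constUnit K a) = g (constUnit K a))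
    (hL : ∀ a, f (lin a) = g (lin a)) (R : Additive (RatFunc K)ˣ) : f R = g R :=
  unit_induction (P := fun R => f R = g R) hC hL (fun R S hR hS => by rw [map_add, map_add, hR, hS])
    (fun R hR => by rw [map_neg, map_neg, hR]) R

variable {k : Type*} [Field k] [Algebra k K]

theorem coeffHom_constUnit (γ : Gal(K/k)) (a : Additive Kˣ) :
    unitsRep (coeffHom k K) γ (constUnit K a) = constUnit K (unitsRep (galHom k K) γ a) := by
  apply Additive.toMul.injective
  ext
  exact coeffMap_C _ _

theorem coeffHom_lin (γ : Gal(K/k)) (a : K) :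
    unitsRep (coeffHom k K) γ (lin a) = lin (γ a) := by
  apply Additive.toMul.injective
  ext
  show coeffMap _ (RatFunc.X - RatFunc.C a) = RatFunc.X - RatFunc.C (γ a)
  rw [map_sub, coeffMap_X, coeffMap_C]
  rfl

theorem lead_coeffHom [IsAlgClosed K] (γ : Gal(K/k)) (R : Additive (RatFunc K)ˣ) :
    lead K (unitsRep (coeffHom k K) γ R) = unitsRep (galHom k K) γ (lead K R) := by
  refine unit_hom_ext (f := (lead K).comp (unitsRep (coeffHom k K) γ))
    (g := AddMonoidHom.comp (unitsRep (galHom k K) γ) (lead K)) (fun a => ?_) (fun a => ?_) R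
  · show lead K (unitsRep (coeffHom k K) γ _) = unitsRep (galHom k K) γ (lead K _)
    rw [coeffHom_constUnit, lead_constUnit, lead_constUnit]
  · show lead K (unitsRep (coeffHom k K) γ _) = unitsRep (galHom k K) γ (lead K _)
    rw [coeffHom_lin, lead_lin, lead_lin, map_zero]

theorem ordAt_coeffHom [IsAlgClosed K] (γ : Gal(K/k)) (b : K) (R : Additive (RatFunc K)ˣ) :
    ordAt (γ b) (unitsRep (coeffHom k K) γ R) = ordAt b R := by
  refine unit_hom_ext (f := (ordAt (γ b)).comp (unitsRep (coeffHom k K) γ))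
    (g := ordAt b) (fun a => ?_) (fun a => ?_) R
  · show ordAt (γ b) (unitsRep (coeffHom k K) γ _) = _
    rw [coeffHom_constUnit, ordAt_constUnit, ordAt_constUnit]
  · show ordAt (γ b) (unitsRep (coeffHom k K) γ _) = _
    rw [coeffHom_lin]
    by_cases h : b = a
    · rw [h, ordAt_lin_self, ordAt_lin_self]
    · rw [ordAt_lin_of_ne h, ordAt_lin_of_ne (fun h' => h (γ.injective h'))]

end Units

/-! ### The automorphism `s` on divisors, and factorization by Galois orbits -/

namespace Datum

variable {k K : Type*} [Field k] [Field K] [Algebra k K] (D : Datum k K)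

theorem ratRep_constUnit (g : D.G) (a : Additive Kˣ) :
    D.ratRep g (constUnit K a) = constUnit K (D.constRep g a) :=
  coeffHom_constUnit _ a

theorem sUnits_constUnit (a : Additive Kˣ) :
    D.sUnits (constUnit K a) = constUnit K (unitsRep (galHom k K) D.σ a) := by
  apply Additive.toMul.injective
  ext
  exact D.s_C _

/-- `s(u) = c / u`. -/
theorem sUnits_lin_zero : D.sUnits (lin 0) =
    constUnit K (Additive.ofMul (Units.mk0 _ D.c_ne_zero')) - lin 0 := by
  apply Additive.toMul.injective
  ext
  rw [toMul_sub, Units.val_div_eq_div_val, coe_toMul_constUnit, coe_toMul_lin]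
  show D.s ((lin (0 : K)).toMul : RatFunc K) = _
  rw [coe_toMul_lin, map_zero, sub_zero, s_X]
  rfl

/-- `s(u - a) = -σ(a) (u - c / σ(a)) / u`. -/
theorem sUnits_lin {a : K} (ha : a ≠ 0) : D.sUnits (lin a) =
    constUnit K (Additive.ofMul (Units.mk0 (-D.σ a) (neg_ne_zero.2 ((map_ne_zero D.σ).2 ha)))) +
      lin (algebraMap k K D.c / D.σ a) - lin 0 := by
  have hσ : (RatFunc.C (D.σ a) : RatFunc K) ≠ 0 :=
    (map_ne_zero _).2 ((map_ne_zero D.σ).2 ha)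
  have hX := X_ne_zero (K := K)
  apply Additive.toMul.injective
  ext
  rw [toMul_sub, toMul_add, Units.val_div_eq_div_val, Units.val_mul, coe_toMul_constUnit,
    coe_toMul_lin, coe_toMul_lin]
  show D.s ((lin a).toMul : RatFunc K) = _
  rw [coe_toMul_lin, map_sub, s_X, s_C, map_zero, sub_zero, map_div₀]
  show _ = RatFunc.C (-D.σ a) * _ / _
  rw [map_neg]
  field_simp
  ring

/-- Away from $0$ and $\infty$, $s$ moves a zero at $b'$ to $c/\sigma(b')$. The point $b=0$ is
excluded because the factor $1/u$ contributes there. -/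
theorem ordAt_sUnits [IsAlgClosed K] {b b' : K} (hb : b ≠ 0)
    (h : b * D.σ b' = algebraMap k K D.c) (R : Additive (RatFunc K)ˣ) :
    ordAt b (D.sUnits R) = ordAt b' R := by
  have hb' : D.σ b' ≠ 0 := fun h0 => D.c_ne_zero' (by rw [← h, h0, mul_zero])
  have hb'0 : b' ≠ 0 := (map_ne_zero D.σ).1 hb'
  refine unit_hom_ext (f := (ordAt b).comp D.sUnits) (g := ordAt b') (fun a => ?_) (fun a => ?_) R
  · show ordAt b (D.sUnits _) = _
    rw [sUnits_constUnit, ordAt_constUnit, ordAt_constUnit]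
  · show ordAt b (D.sUnits _) = _
    by_cases ha : a = 0
    · rw [ha, sUnits_lin_zero, map_sub, ordAt_constUnit, ordAt_lin_of_ne hb, ordAt_lin_of_ne hb'0,
        sub_zero]
    · rw [D.sUnits_lin ha, map_sub, map_add, ordAt_constUnit, ordAt_lin_of_ne hb]
      have hσ : D.σ a ≠ 0 := (map_ne_zero D.σ).2 ha
      by_cases hab : b' = a
      · obtain rfl := hab
        rw [← h, mul_div_cancel_right₀ _ hb', ordAt_lin_self, ordAt_lin_self]
        simp
      · rw [ordAt_lin_of_ne hab, ordAt_lin_of_ne]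
        · simp
        · intro h'
          rw [eq_div_iff hσ, ← h] at h'
          exact hab (D.σ.injective (mul_left_cancel₀ hb h')).symm

/-- The pole at infinity of $u-a$ is moved to $0$. This $-1$ is the source of the corestriction in
the $u$-component of $s^*$. -/
theorem ordAt_zero_sUnits_lin {a : K} (ha : a ≠ 0) : ordAt 0 (D.sUnits (lin a)) = -1 := by
  rw [D.sUnits_lin ha, map_sub, map_add, ordAt_constUnit, ordAt_lin_self, ordAt_lin_of_ne]
  · simp
  · exact (div_ne_zero D.c_ne_zero' ((map_ne_zero D.σ).2 ha)).symm

/-- `s²` is the action of `σ²` on the coefficients. -/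
theorem sUnits_sUnits (R : Additive (RatFunc K)ˣ) :
    D.sUnits (D.sUnits R) = unitsRep (coeffHom k K) (D.σ * D.σ) R := by
  have h : D.s.comp D.s = coeffHom k K (D.σ * D.σ) := by
    have hc : (RatFunc.C (algebraMap k K D.c) : RatFunc K) ≠ 0 := by simpa using D.c_ne_zero
    apply ratFunc_hom_ext
    · intro a
      simp [coeffHom, s_C]
    · simp [coeffHom, s_C, s_X, div_div_cancel₀ hc]
  apply Additive.toMul.injective
  ext
  exact DFunLike.congr_fun h _

theorem place_eq_of_root {p q : Place D.l} {a : K} (hp : Polynomial.aeval a p.1 = 0)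
    (hq : Polynomial.aeval a q.1 = 0) : p = q :=
  Subtype.ext ((minpoly.eq_of_irreducible_of_monic p.2.2.1 hp p.2.1).trans
    (minpoly.eq_of_irreducible_of_monic q.2.2.1 hq q.2.1).symm)

theorem aeval_apply_root (p : Place D.l) (τ : D.G) :
    Polynomial.aeval ((τ : Gal(K/k)) (D.root p)) p.1 = 0 := by
  rw [D.aeval_apply_of_mem τ.2, D.aeval_root, map_zero]

theorem apply_root_eq_iff (p : Place D.l) (τ τ' : D.G) :
    (τ : Gal(K/k)) (D.root p) = (τ' : Gal(K/k)) (D.root p) ↔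
      (τ : D.G ⧸ (D.H p).subgroupOf D.G) = τ' := by
  rw [QuotientGroup.eq, Subgroup.mem_subgroupOf, mem_H]
  constructor
  · intro h
    refine ⟨D.mem_G.1 (τ⁻¹ * τ').2, ?_⟩
    show (τ : Gal(K/k))⁻¹ ((τ' : Gal(K/k)) (D.root p)) = _
    rw [← h, ← AlgEquiv.mul_apply, inv_mul_cancel, AlgEquiv.one_apply]
  · rintro ⟨-, h⟩
    conv_lhs => rw [← h]
    rw [← AlgEquiv.mul_apply, ← Subgroup.coe_mul, mul_inv_cancel_left]

theorem apply_root_ne_zero (p : Place D.l) (γ : Gal(K/k)) : γ (D.root p) ≠ 0 :=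
  (map_ne_zero γ).2 (D.root_ne_zero p)

/-- The divisor of a rational function along `p`, as an element of the induced module. -/
def valAt (p : Place D.l) : Additive (RatFunc K)ˣ →+ Ind (D.H p) D.G where
  toFun R := ⟨fun g => ordAt ((g⁻¹ : D.G) • D.root p) R, fun h g hh => by
    have h1 : (((h * g)⁻¹ : D.G) : Gal(K/k)) (D.root p) = ((g⁻¹ : D.G) : Gal(K/k)) (D.root p) := by
      rw [apply_root_eq_iff, QuotientGroup.eq, Subgroup.mem_subgroupOf]
      simpa using hh
    exact congrArg (fun b => ordAt b R) h1⟩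
  map_zero' := by ext; simp
  map_add' R S := by ext; simp

theorem valAt_apply (p : Place D.l) (R : Additive (RatFunc K)ˣ) (g : D.G) :
    (D.valAt p R).1 g = ordAt (((g⁻¹ : D.G) : Gal(K/k)) (D.root p)) R := rfl

variable [PerfectField k] [IsAlgClosure k K]

/-- Every nonzero element of `K` is a conjugate of a chosen root. -/
theorem exists_root_conj {a : K} (ha : a ≠ 0) :
    ∃ (p : Place D.l) (τ : D.G), (τ : Gal(K/k)) (D.root p) = a := by
  have : Algebra.IsAlgebraic k K := IsAlgClosure.isAlgebraic
  have hint : IsIntegral D.l a := Algebra.IsIntegral.isIntegral _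
  let p : Place D.l := ⟨minpoly D.l a, minpoly.monic hint, minpoly.irreducible hint, fun h => by
    have h0 := minpoly.aeval D.l a
    rw [h, Polynomial.aeval_X] at h0
    exact ha h0⟩
  obtain ⟨τ, hτ, h⟩ := D.exists_mem_G_of_root p (D.aeval_root p) (minpoly.aeval D.l a)
  exact ⟨p, ⟨τ, hτ⟩, h⟩

theorem iota_eq_finsum (p : Place D.l) (x : Ind (D.H p) D.G) :
    D.iota p x = ∑ᶠ q : D.G ⧸ (D.H p).subgroupOf D.G,
      x.1 q.out⁻¹ • lin ((q.out : Gal(K/k)) (D.root p)) := by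
  have := D.finiteIndex_H p
  let _ := ((D.H p).subgroupOf D.G).fintypeQuotientOfFiniteIndex
  rw [finsum_eq_sum_of_fintype]
  show Additive.ofMul (∏ᶠ q, D.iotaTerm p x q) = _
  rw [finprod_eq_prod_of_fintype, ofMul_prod]
  refine Finset.sum_congr rfl fun q _ => ?_
  conv_lhs => rw [← QuotientGroup.out_eq' q]
  show Additive.ofMul (linUnit _ ^ x.1 _) = _
  rw [ofMul_zpow]
  rfl

theorem map_iota {A : Type*} [AddCommGroup A] (f : Additive (RatFunc K)ˣ →+ A) (p : Place D.l)
    (x : Ind (D.H p) D.G) : f (D.iota p x) = ∑ᶠ q : D.G ⧸ (D.H p).subgroupOf D.G,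
      x.1 q.out⁻¹ • f (lin ((q.out : Gal(K/k)) (D.root p))) := by
  have := D.finiteIndex_H p
  rw [iota_eq_finsum, AddMonoidHom.map_finsum _ (Set.toFinite _)]
  simp only [map_zsmul]

theorem lead_iota (p : Place D.l) (x : Ind (D.H p) D.G) : lead K (D.iota p x) = 0 := by
  simp [map_iota, lead_lin]

theorem ordAt_iota_root (p : Place D.l) (x : Ind (D.H p) D.G) (τ : D.G) :
    ordAt ((τ : Gal(K/k)) (D.root p)) (D.iota p x) = x.1 τ⁻¹ := by
  rw [map_iota, finsum_eq_single _ (τ : D.G ⧸ (D.H p).subgroupOf D.G)]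
  · have h1 : ((τ : D.G ⧸ (D.H p).subgroupOf D.G).out : Gal(K/k)) (D.root p) =
        (τ : Gal(K/k)) (D.root p) := (D.apply_root_eq_iff p _ _).2 (QuotientGroup.out_eq' _)
    rw [h1, ordAt_lin_self, smul_eq_mul, mul_one]
    have := apply_out_inv (H := D.H p) x.2 τ⁻¹
    rwa [inv_inv] at this
  · intro q hq
    rw [ordAt_lin_of_ne, smul_zero]
    intro h
    refine hq ?_
    rw [(D.apply_root_eq_iff p _ _).1 h]
    exact (QuotientGroup.out_eq' q).symm

theorem ordAt_iota_of_ne (p : Place D.l) (x : Ind (D.H p) D.G) {b : K}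
    (hb : ∀ τ : D.G, b ≠ (τ : Gal(K/k)) (D.root p)) : ordAt b (D.iota p x) = 0 := by
  rw [map_iota]
  simp [ordAt_lin_of_ne (hb _)]

theorem valAt_ratRep (p : Place D.l) (g : D.G) (R : Additive (RatFunc K)ˣ) :
    D.valAt p (D.ratRep g R) = indRep (D.H p) D.G g (D.valAt p R) := by
  have : IsAlgClosed K := IsAlgClosure.isAlgClosed k
  ext x
  show (D.valAt p (D.ratRep g R)).1 x = (D.valAt p R).1 (x * g)
  rw [valAt_apply, valAt_apply, ← ordAt_coeffHom (k := k) g _ R, ← AlgEquiv.mul_apply,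
    ← Subgroup.coe_mul, mul_inv_rev, mul_inv_cancel_left]
  rfl

theorem valAt_iota (p : Place D.l) (x : Ind (D.H p) D.G) : D.valAt p (D.iota p x) = x := by
  ext g
  rw [valAt_apply, ordAt_iota_root, inv_inv]

theorem valAt_iota_of_ne {p q : Place D.l} (h : p ≠ q) (x : Ind (D.H p) D.G) :
    D.valAt q (D.iota p x) = 0 := by
  ext g
  rw [valAt_apply, ordAt_iota_of_ne]
  · rfl
  · intro τ hτ
    refine h (D.place_eq_of_root (D.aeval_apply_root p τ) ?_)
    rw [← hτ]
    exact D.aeval_apply_root q _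

theorem valAt_constUnit (p : Place D.l) (a : Additive Kˣ) : D.valAt p (constUnit K a) = 0 := by
  ext g
  rw [valAt_apply, ordAt_constUnit]
  rfl

theorem valAt_lin_zero (p : Place D.l) : D.valAt p (lin 0) = 0 := by
  ext g
  rw [valAt_apply, ordAt_lin_of_ne (D.apply_root_ne_zero p _)]
  rfl

theorem ordAt_zero_iota (p : Place D.l) (x : Ind (D.H p) D.G) : ordAt 0 (D.iota p x) = 0 :=
  D.ordAt_iota_of_ne p x fun _ => (D.apply_root_ne_zero p _).symm

/-- The factorization of rational functions, sorted by the orbits of the Galois group. -/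
theorem exists_finset_eq_sum (R : Additive (RatFunc K)ˣ) : ∃ S : Finset (Place D.l), ∀ T, S ⊆ T →
    constUnit K (lead K R) + ordAt 0 R • lin 0 + ∑ p ∈ T, D.iota p (D.valAt p R) = R := by
  classical
  have : IsAlgClosed K := IsAlgClosure.isAlgClosed k
  induction R using unit_induction with
  | hC a =>
    refine ⟨∅, fun T _ => ?_⟩
    simp [lead_constUnit, ordAt_constUnit, valAt_constUnit]
  | hL a =>
    by_cases ha : a = 0
    · obtain rfl := ha
      refine ⟨∅, fun T _ => ?_⟩
      simp [lead_lin, ordAt_lin_self, valAt_lin_zero]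
    · obtain ⟨p, τ, rfl⟩ := D.exists_root_conj ha
      refine ⟨{p}, fun T hT => ?_⟩
      -- The divisor of $u-\tau(a_p)$ along $p$ is the indicator function of one coset.
      have hlin : lin ((τ : Gal(K/k)) (D.root p)) = D.iota p
          (D.valAt p (lin ((τ : Gal(K/k)) (D.root p)))) := by
        rw [iota_eq_finsum, finsum_eq_single _ (τ : D.G ⧸ (D.H p).subgroupOf D.G)]
        · have h1 : ((τ : D.G ⧸ (D.H p).subgroupOf D.G).out : Gal(K/k)) (D.root p) =
            (τ : Gal(K/k)) (D.root p) := (D.apply_root_eq_iff p _ _).2 (QuotientGroup.out_eq' _)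
          rw [valAt_apply, inv_inv, h1, ordAt_lin_self, one_smul]
        · intro q hq
          rw [valAt_apply, inv_inv, ordAt_lin_of_ne, zero_smul]
          intro h
          refine hq ?_
          rw [← (D.apply_root_eq_iff p _ _).1 h]
          exact (QuotientGroup.out_eq' q).symm
      rw [lead_lin, ordAt_lin_of_ne (Ne.symm ha), Finset.sum_eq_single p, ← hlin]
      · simp
      · intro q _ hq
        rw [hlin, D.valAt_iota_of_ne hq.symm, map_zero]
      · intro h
        exact absurd (hT (Finset.mem_singleton_self p)) h
  | hadd R R' hR hR' =>
    obtain ⟨S, hS⟩ := hR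
    obtain ⟨S', hS'⟩ := hR'
    -- The formula is required for every larger $T$, so that a common finite set serves both units.
    refine ⟨S ∪ S', fun T hT => ?_⟩
    conv_rhs => rw [← hS T (Finset.union_subset_left hT), ← hS' T (Finset.union_subset_right hT)]
    simp only [map_add, add_zsmul, Finset.sum_add_distrib]
    abel
  | hneg R hR =>
    obtain ⟨S, hS⟩ := hR
    refine ⟨S, fun T hT => ?_⟩
    conv_rhs => rw [← hS T hT]
    simp only [map_neg, neg_zsmul, Finset.sum_neg_distrib]
    abel

end Datum

/-- The connecting homomorphism commutes with pullback. -/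
theorem delta_comp {G G' : Type*} [Group G] [TopologicalSpace G] [ContinuousMul G] [Group G']
    [TopologicalSpace G'] [ContinuousMul G'] (φ : G' →* G) (hφ : Continuous φ) (χ : Chars G)
    (χ' : Chars G') (h : ∀ g, χ'.1 g = χ.1 (φ g)) :
    delta χ' = H2.map φ hφ (AddMonoidHom.id ℤ) (fun _ _ => rfl) (delta χ) := by
  refine congrArg (H2.mk _) (Subtype.ext (funext fun g => ?_))
  show deltaFun χ'.1 g = deltaFun χ.1 (φ g.1, φ g.2)
  simp only [deltaFun, ratLift, h, map_mul]

/-! ### The involution `s^*` and the decomposition of $\mathrm{Br}(l(u))$ -/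

namespace Datum

variable {k K : Type*} [Field k] [Field K] [Algebra k K] (D : Datum k K)

theorem constMap_eq (β : D.Br) : D.constMap β =
    H2.map (MonoidHom.id _) continuous_id (constUnit K) (fun g m => (D.ratRep_constUnit g m).symm)
      β := rfl

theorem piHom_apply (e : ℤ) :
    zmultiplesHom _ (Additive.ofMul (uUnit K)) e = e • lin (0 : K) := by
  rw [lin_zero, zmultiplesHom_apply]

theorem σ_mul_σ_mem : D.σ * D.σ ∈ D.G := by
  have hσ : D.σ D.sqrtd = -D.sqrtd := (D.gal_sqrtd D.σ).resolve_left D.σ_sqrtd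
  rw [mem_G, AlgEquiv.mul_apply, hσ, map_neg, hσ, neg_neg]

theorem conjσ_conjσ (g : D.G) :
    D.conjσ (D.conjσ g) = (⟨_, D.σ_mul_σ_mem⟩ : D.G)⁻¹ * g * ⟨_, D.σ_mul_σ_mem⟩ := by
  ext1
  show D.σ⁻¹ * (D.σ⁻¹ * g * D.σ) * D.σ = (D.σ * D.σ)⁻¹ * g * (D.σ * D.σ)
  group

/-- Since $\sigma^2\in G_l$ and a character is invariant under inner conjugation, $\sigma$ acts as
an involution. -/
theorem σChar_σChar (χ : Chars D.G) : D.σChar (D.σChar χ) = χ := by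
  ext g
  show χ.1 (D.conjσ (D.conjσ g)) = χ.1 g
  have h1 := χ.2.2 ((⟨_, D.σ_mul_σ_mem⟩ : D.G)⁻¹ * g) ⟨_, D.σ_mul_σ_mem⟩
  have h2 := χ.2.2 ⟨_, D.σ_mul_σ_mem⟩ ((⟨_, D.σ_mul_σ_mem⟩ : D.G)⁻¹ * g)
  rw [mul_inv_cancel_left] at h2
  rw [conjσ_conjσ, h1, h2, add_comm]

theorem delta_σChar (χ : Chars D.G) : delta (D.σChar χ) =
    H2.map D.conjσ D.continuous_conjσ (AddMonoidHom.id ℤ) (fun _ _ => rfl) (delta χ) :=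
  delta_comp D.conjσ D.continuous_conjσ χ _ fun _ => rfl

/-- On the group and on the coefficients alike, the square is the action of $\sigma^2\in G_l$, which
is trivial on cohomology. -/
theorem sStar_sStar (z : D.BrRat) : D.sStar (D.sStar z) = z := by
  rw [sStar, H2.map_map]
  exact H2.map_inner ⟨_, D.σ_mul_σ_mem⟩ D.conjσ_conjσ D.sUnits_sUnits z

theorem sStar_constMap (β : D.Br) : D.sStar (D.constMap β) = D.constMap (D.σBr β) := by
  obtain ⟨f, rfl⟩ := H2.exists_rep β
  refine congrArg (H2.mk _) (Subtype.ext (funext fun g => ?_))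
  exact D.sUnits_constUnit _

variable [PerfectField k] [IsAlgClosure k K]

theorem isGalois_of_isAlgClosure (k K : Type*) [Field k] [PerfectField k] [Field K] [Algebra k K]
    [IsAlgClosure k K] : IsGalois k K := by
  have : Algebra.IsAlgebraic k K := IsAlgClosure.isAlgebraic
  have : Normal k K := IsAlgClosure.normal k K
  exact {}

theorem compactSpace_G : CompactSpace D.G := by
  have := isGalois_of_isAlgClosure k K
  exact isCompact_iff_compactSpace.1 (InfiniteGalois.fixingSubgroup_isClosed D.l).isCompact

theorem compactSpace_H (p : Place D.l) : CompactSpace (D.H p) := by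
  have := isGalois_of_isAlgClosure k K
  exact isCompact_iff_compactSpace.1
    (InfiniteGalois.fixingSubgroup_isClosed (D.lRoot p)).isCompact

theorem shapiroInv_bij (p : Place D.l) :
    Function.Bijective (shapiroInv (D.H p) D.G (D.H_le p)) := by
  have := D.finiteIndex_H p
  have : Algebra.IsAlgebraic k K := IsAlgClosure.isAlgebraic
  exact shapiroInv_bijective (D.H_le p) (D.isOpen_H p)

theorem delta_bij : Function.Bijective (delta : Chars D.G →+ _) := by
  have := D.compactSpace_G
  exact ⟨delta_injective, delta_surjective⟩

theorem delta_bij_H (p : Place D.l) : Function.Bijective (delta : Chars (D.H p) →+ _) := by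
  have := D.compactSpace_H p
  exact ⟨delta_injective, delta_surjective⟩

/-- The isomorphism `X(l(a_p)) → H²(G_l, A)`. -/
def shDelta (p : Place D.l) : Chars (D.H p) ≃+ H2 (indRep (D.H p) D.G) :=
  (AddEquiv.ofBijective _ (D.delta_bij_H p)).trans
    (AddEquiv.ofBijective _ (D.shapiroInv_bij p)).symm

theorem shapiroInv_shDelta (p : Place D.l) (χ : Chars (D.H p)) :
    shapiroInv (D.H p) D.G (D.H_le p) (D.shDelta p χ) = delta χ :=
  (AddEquiv.ofBijective _ (D.shapiroInv_bij p)).apply_symm_apply (delta χ)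

theorem lead_ratRep (g : D.G) (R : Additive (RatFunc K)ˣ) :
    lead K (D.ratRep g R) = D.constRep g (lead K R) :=
  have : IsAlgClosed K := IsAlgClosure.isAlgClosed k
  lead_coeffHom (g : Gal(K/k)) R

theorem ordAt_zero_ratRep (g : D.G) (R : Additive (RatFunc K)ˣ) :
    ordAt 0 (D.ratRep g R) = (1 : D.G →* AddMonoid.End ℤ) g (ordAt 0 R) := by
  have : IsAlgClosed K := IsAlgClosure.isAlgClosed k
  have := ordAt_coeffHom (g : Gal(K/k)) 0 R
  rwa [map_zero] at this

/-- The projection `Br(l(u)) → Br(l)` given by the leading coefficient. -/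
def prLead : D.BrRat →+ D.Br :=
  H2.map (MonoidHom.id _) continuous_id (lead K) D.lead_ratRep

/-- The projection `Br(l(u)) → H²(G_l, ℤ)` given by the order at `0`. -/
def prU : D.BrRat →+ H2 (1 : D.G →* AddMonoid.End ℤ) :=
  H2.map (MonoidHom.id _) continuous_id (ordAt 0) D.ordAt_zero_ratRep

/-- The projection `Br(l(u)) → H²(G_l, A)` given by the divisor along `p`. -/
def prP (p : Place D.l) : D.BrRat →+ H2 (indRep (D.H p) D.G) :=
  H2.map (MonoidHom.id _) continuous_id (D.valAt p) (D.valAt_ratRep p)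

theorem prLead_constMap (β : D.Br) : D.prLead (D.constMap β) = β := by
  rw [constMap_eq, prLead, H2.map_map]
  exact H2.map_eq_self (fun _ => rfl) lead_constUnit β

theorem prLead_piMap (h : H2 (1 : D.G →* AddMonoid.End ℤ)) : D.prLead (D.piMap h) = 0 := by
  rw [piMap, prLead, H2.map_map]
  refine H2.map_eq_zero (fun e => ?_) h
  rw [AddMonoidHom.comp_apply, piHom_apply, map_zsmul, lead_lin, smul_zero]

theorem prLead_iotaMap (p : Place D.l) (y : H2 (indRep (D.H p) D.G)) :
    D.prLead (D.iotaMap p y) = 0 := by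
  rw [iotaMap, prLead, H2.map_map]
  exact H2.map_eq_zero (D.lead_iota p) y

theorem prU_constMap (β : D.Br) : D.prU (D.constMap β) = 0 := by
  rw [constMap_eq, prU, H2.map_map]
  exact H2.map_eq_zero (ordAt_constUnit 0) β

theorem prU_piMap (h : H2 (1 : D.G →* AddMonoid.End ℤ)) : D.prU (D.piMap h) = h := by
  rw [piMap, prU, H2.map_map]
  refine H2.map_eq_self (fun _ => rfl) (fun e => ?_) h
  rw [AddMonoidHom.comp_apply, piHom_apply, map_zsmul, ordAt_lin_self, smul_eq_mul, mul_one]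

theorem prU_iotaMap (p : Place D.l) (y : H2 (indRep (D.H p) D.G)) :
    D.prU (D.iotaMap p y) = 0 := by
  rw [iotaMap, prU, H2.map_map]
  exact H2.map_eq_zero (D.ordAt_zero_iota p) y

theorem prP_constMap (p : Place D.l) (β : D.Br) : D.prP p (D.constMap β) = 0 := by
  rw [constMap_eq, prP, H2.map_map]
  exact H2.map_eq_zero (D.valAt_constUnit p) β

theorem prP_piMap (p : Place D.l) (h : H2 (1 : D.G →* AddMonoid.End ℤ)) :
    D.prP p (D.piMap h) = 0 := by
  rw [piMap, prP, H2.map_map]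
  refine H2.map_eq_zero (fun e => ?_) h
  rw [AddMonoidHom.comp_apply, piHom_apply, map_zsmul, valAt_lin_zero, smul_zero]

theorem prP_iotaMap (p : Place D.l) (y : H2 (indRep (D.H p) D.G)) :
    D.prP p (D.iotaMap p y) = y := by
  rw [iotaMap, prP, H2.map_map]
  exact H2.map_eq_self (fun _ => rfl) (D.valAt_iota p) y

theorem prP_iotaMap_of_ne {p q : Place D.l} (hpq : p ≠ q) (y : H2 (indRep (D.H p) D.G)) :
    D.prP q (D.iotaMap p y) = 0 := by
  rw [iotaMap, prP, H2.map_map]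
  exact H2.map_eq_zero (D.valAt_iota_of_ne hpq) y

/-- Only finitely many of the projections of a class are needed to recover it. -/
theorem exists_eq_sum (z : D.BrRat) : ∃ T : Finset (Place D.l),
    D.constMap (D.prLead z) + D.piMap (D.prU z) + ∑ p ∈ T, D.iotaMap p (D.prP p z) = z := by
  classical
  have := D.compactSpace_G
  obtain ⟨f, rfl⟩ := H2.exists_rep z
  choose S hS using D.exists_finset_eq_sum
  -- Compactness of $G_l$ leaves finitely many values of the cocycle, hence finitely many relevant
  -- $p$.
  have hfin := f.2.1.range_finite
  let T := hfin.toFinset.biUnion S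
  refine ⟨T, ?_⟩
  -- These are the projectors onto the summands of $\bar k(u)^*$, applied to cocycles. They are
  -- equivariant, so the factorization already holds on the level of cocycles.
  let cC : Z2 D.ratRep →+ Z2 D.ratRep :=
    Z2.map (MonoidHom.id _) continuous_id ((constUnit K).comp (lead K)) fun g m => by
      have : IsAlgClosed K := IsAlgClosure.isAlgClosed k
      rw [AddMonoidHom.comp_apply, AddMonoidHom.comp_apply, ratRep_constUnit]
      exact congrArg _ (lead_coeffHom (g : Gal(K/k)) m)
  let cU : Z2 D.ratRep →+ Z2 D.ratRep :=
    Z2.map (MonoidHom.id _) continuous_id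
      ((zmultiplesHom _ (Additive.ofMul (uUnit K))).comp (ordAt 0)) fun g m => by
      have : IsAlgClosed K := IsAlgClosure.isAlgClosed k
      have h1 := ordAt_coeffHom (g : Gal(K/k)) 0 m
      rw [map_zero] at h1
      have h2 : D.ratRep g (lin 0) = lin 0 := by
        have := coeffHom_lin (g : Gal(K/k)) 0
        rwa [map_zero] at this
      rw [AddMonoidHom.comp_apply, AddMonoidHom.comp_apply, piHom_apply, piHom_apply, map_zsmul, h2]
      exact congrArg (· • lin 0) h1
  let cP : Place D.l → Z2 D.ratRep →+ Z2 D.ratRep := fun p =>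
    Z2.map (MonoidHom.id _) continuous_id ((D.iota p).comp (D.valAt p)) fun g m => by
      rw [AddMonoidHom.comp_apply, AddMonoidHom.comp_apply, ← iota_equivariant]
      exact congrArg _ (D.valAt_ratRep p g m)
  have key : cC f + cU f + ∑ p ∈ T, cP p f = f := by
    ext1
    funext g
    rw [AddSubgroup.coe_add, AddSubgroup.coe_add, AddSubgroup.val_finsetSum, Pi.add_apply,
      Pi.add_apply, Finset.sum_apply]
    have hT : S (f.1 g) ⊆ T :=
      Finset.subset_biUnion_of_mem S (hfin.mem_toFinset.2 ⟨g, rfl⟩)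
    conv_rhs => rw [← hS _ _ hT]
    rw [← piHom_apply]
    rfl
  conv_rhs => rw [← key, map_add, map_add, map_sum]
  rfl

open Classical in
/-- The Auslander-Brumer-Faddeev homomorphism. -/
def abfHom : D.Dec →+ D.BrRat :=
  D.constMap.coprod ((D.piMap.comp delta).coprod
    (DirectSum.toAddMonoid fun p => (D.iotaMap p).comp (D.shDelta p).toAddMonoidHom))

theorem abfHom_inclAt (p : Place D.l) (χ : Chars (D.H p)) :
    D.abfHom (D.inclAt p χ) = D.iotaMap p (D.shDelta p χ) := by
  simp [abfHom, inclAt]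

theorem abfHom_const (β : D.Br) : D.abfHom (β, 0, 0) = D.constMap β := by
  simp [abfHom]

theorem abfHom_u (χ : Chars D.G) : D.abfHom (0, χ, 0) = D.piMap (delta χ) := by
  simp [abfHom]

theorem dec_induction {P : D.Dec → Prop} (h₁ : ∀ β, P (β, 0, 0)) (h₂ : ∀ χ, P (0, χ, 0))
    (h₃ : ∀ p χ, P (D.inclAt p χ)) (hadd : ∀ x y, P x → P y → P (x + y)) (x : D.Dec) : P x := by
  classical
  obtain ⟨β, χ, d⟩ := x
  have hd : P (0, 0, d) := by
    induction d using DirectSum.induction_on with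
    | zero => exact h₂ 0
    | of p χ =>
      convert! h₃ p χ
    | add d d' hd hd' => simpa using hadd _ _ hd hd'
  simpa using hadd _ _ (h₁ β) (hadd _ _ (h₂ χ) hd)

theorem prLead_abfHom (x : D.Dec) : D.prLead (D.abfHom x) = x.1 := by
  induction x using D.dec_induction with
  | h₁ β => rw [abfHom_const, prLead_constMap]
  | h₂ χ => rw [abfHom_u, prLead_piMap]
  | h₃ p χ => rw [abfHom_inclAt, prLead_iotaMap]; rfl
  | hadd x y hx hy => rw [map_add, map_add, hx, hy]; rfl

theorem prU_abfHom (x : D.Dec) : D.prU (D.abfHom x) = delta x.2.1 := by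
  induction x using D.dec_induction with
  | h₁ β => rw [abfHom_const, prU_constMap, map_zero]
  | h₂ χ => rw [abfHom_u, prU_piMap]
  | h₃ p χ => rw [abfHom_inclAt, prU_iotaMap]; exact (map_zero _).symm
  | hadd x y hx hy => rw [map_add, map_add, hx, hy]; exact (map_add _ _ _).symm

theorem inclAt_self (p : Place D.l) (χ : Chars (D.H p)) : (D.inclAt p χ).2.2 p = χ := by
  classical
  simp only [inclAt, AddMonoidHom.comp_apply, AddMonoidHom.inr_apply]
  exact DirectSum.of_eq_same _ _

theorem inclAt_of_ne {p q : Place D.l} (h : p ≠ q) (χ : Chars (D.H p)) :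
    (D.inclAt p χ).2.2 q = 0 := by
  classical
  simp only [inclAt, AddMonoidHom.comp_apply, AddMonoidHom.inr_apply]
  exact DirectSum.of_eq_of_ne _ _ _ h.symm

theorem prP_abfHom (p : Place D.l) (x : D.Dec) : D.prP p (D.abfHom x) = D.shDelta p (x.2.2 p) := by
  induction x using D.dec_induction with
  | h₁ β => rw [abfHom_const, prP_constMap]; exact (map_zero _).symm
  | h₂ χ => rw [abfHom_u, prP_piMap]; exact (map_zero _).symm
  | h₃ q χ =>
    rw [abfHom_inclAt]
    by_cases h : q = p
    · obtain rfl := h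
      rw [prP_iotaMap, inclAt_self]
    · rw [D.prP_iotaMap_of_ne h, D.inclAt_of_ne h, map_zero]
  | hadd x y hx hy => rw [map_add, map_add, hx, hy]; exact (map_add _ _ _).symm

/-- The projections recover all components of the argument, which gives injectivity; surjectivity is
the finite sum formula together with the bijectivity of $\delta$ and of Shapiro's map. -/
theorem abfHom_bijective : Function.Bijective D.abfHom := by
  constructor
  · rw [injective_iff_map_eq_zero]
    intro x hx
    have h1 := D.prLead_abfHom x
    have h2 := D.prU_abfHom x
    have h3 := fun p => D.prP_abfHom p x
    rw [hx, map_zero] at h1 h2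
    simp only [hx, map_zero] at h3
    refine Prod.ext h1.symm (Prod.ext ?_ (DFinsupp.ext fun p => ?_))
    · exact (injective_iff_map_eq_zero _).1 D.delta_bij.1 _ h2.symm
    · exact (map_eq_zero_iff _ (D.shDelta p).injective).1 (h3 p).symm
  · intro z
    obtain ⟨T, hT⟩ := D.exists_eq_sum z
    obtain ⟨χ, hχ⟩ := D.delta_bij.2 (D.prU z)
    refine ⟨(D.prLead z, 0, 0) + (0, χ, 0) +
      ∑ p ∈ T, D.inclAt p ((D.shDelta p).symm (D.prP p z)), ?_⟩
    rw [map_add, map_add, map_sum, abfHom_const, abfHom_u, hχ]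
    simpa only [abfHom_inclAt, AddEquiv.apply_symm_apply] using hT

/-- The class $y$ that `atP` asserts to exist is unique because the inverse Shapiro map is
injective, and the summands generate. -/
theorem IsABF.apply_eq {D : Datum k K} {e : D.Dec ≃+ D.BrRat} (he : D.IsABF e) (x : D.Dec) :
    e x = D.abfHom x := by
  induction x using D.dec_induction with
  | h₁ β => rw [he.const, abfHom_const]
  | h₂ χ => rw [he.atU, abfHom_u]
  | h₃ p χ =>
    obtain ⟨y, hy, h⟩ := he.atP p χ
    rw [← D.shapiroInv_shDelta] at hy
    rw [h, (D.shapiroInv_bij p).1 hy, abfHom_inclAt]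
  | hadd x y hx hy => rw [map_add, map_add, hx, hy]

theorem existsUnique_isABF : ∃! e : D.Dec ≃+ D.BrRat, D.IsABF e := by
  refine ⟨AddEquiv.ofBijective _ D.abfHom_bijective, ⟨D.abfHom_const, D.abfHom_u, fun p χ =>
    ⟨_, D.shapiroInv_shDelta p χ, D.abfHom_inclAt p χ⟩⟩, fun e he => ?_⟩
  ext1 x
  exact he.apply_eq x

end Datum

/-- Conjugation by $\sigma$ alone need not preserve $H$, whereas $\sigma t$ does; on $H$ the two
differ by an inner automorphism of $G$. -/
theorem conjHom_inclusion {Γ : Type*} [Group Γ] [TopologicalSpace Γ] [IsTopologicalGroup Γ]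
    {H G : Subgroup Γ} (σ : Γ) (hle : H ≤ G) (t : G) (hG : ∀ g ∈ G, σ⁻¹ * g * σ ∈ G)
    (h : ∀ g ∈ H, (σ * t)⁻¹ * g * (σ * t) ∈ H) (g : H) :
    conjHom σ G G hG (Subgroup.inclusion hle g) = (MulAut.conj t).toMonoidHom
      (Subgroup.inclusion hle (conjHom (σ * t) H H h g)) := by
  ext1
  show σ⁻¹ * (g : Γ) * σ = t * ((σ * t)⁻¹ * g * (σ * t)) * (t : Γ)⁻¹
  group

namespace Datum

variable {k K : Type*} [Field k] [Field K] [Algebra k K] [PerfectField k] [IsAlgClosure k K]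
  (D : Datum k K)

/-! ## The involution `p ↦ p̃` -/

theorem apply_tilde_eq_zero_iff (p : Place D.l) (b : K) :
    Polynomial.aeval b (D.tilde p).1 = 0 ↔
      ∃ τ : D.G, algebraMap k K D.c / D.σ ((τ : Gal(K/k)) (D.root p)) = b := by
  have h := Set.ext_iff.1 (D.rootSet_tilde p) b
  simp only [Set.mem_image, Polynomial.mem_rootSet_of_ne (D.tilde p).2.1.ne_zero,
    Polynomial.mem_rootSet_of_ne p.2.1.ne_zero] at h
  rw [h]
  constructor
  · rintro ⟨a, ha, rfl⟩
    obtain ⟨τ, hτ, rfl⟩ := D.exists_mem_G_of_root p (D.aeval_root p) ha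
    exact ⟨⟨τ, hτ⟩, rfl⟩
  · rintro ⟨τ, rfl⟩
    exact ⟨_, D.aeval_apply_root p τ, rfl⟩

/-- Applying $a\mapsto c/\sigma(a)$ twice gives $\sigma^2(a)$, a conjugate of $a$ over $l$. -/
theorem tilde_tilde (p : Place D.l) : D.tilde (D.tilde p) = p := by
  obtain ⟨τ, hτ⟩ := (D.apply_tilde_eq_zero_iff p _).1 (D.aeval_root (D.tilde p))
  have hc := D.c_ne_zero'
  refine D.place_eq_of_root (a := algebraMap k K D.c / D.σ (D.root (D.tilde p)))
    ((D.apply_tilde_eq_zero_iff _ _).2 ⟨1, rfl⟩) ?_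
  have h := D.aeval_apply_root p (⟨_, D.σ_mul_σ_mem⟩ * τ)
  rw [← hτ, map_div₀, AlgEquiv.commutes, div_div_cancel₀ hc]
  exact h

/-! ## The components of `s^*` -/

theorem prU_sStar_piMap (χ : Chars D.G) :
    D.prU (D.sStar (D.piMap (delta χ))) = -delta (D.σChar χ) := by
  rw [delta_σChar, prU, sStar, piMap, H2.map_map, H2.map_map]
  refine H2.map_eq_neg (fun _ => rfl) (fun e => ?_) _
  rw [AddMonoidHom.comp_apply, AddMonoidHom.comp_apply, piHom_apply, map_zsmul, map_zsmul,
    sUnits_lin_zero, map_sub, ordAt_constUnit, ordAt_lin_self]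
  simp

theorem prP_sStar_piMap (p : Place D.l) (h : H2 (1 : D.G →* AddMonoid.End ℤ)) :
    D.prP p (D.sStar (D.piMap h)) = 0 := by
  rw [prP, sStar, piMap, H2.map_map, H2.map_map]
  refine H2.map_eq_zero (fun e => ?_) _
  rw [AddMonoidHom.comp_apply, AddMonoidHom.comp_apply, piHom_apply, map_zsmul, map_zsmul,
    sUnits_lin_zero, map_sub, valAt_constUnit, valAt_lin_zero, sub_zero, smul_zero]

theorem degMap_shDelta (p : Place D.l) (χ : Chars (D.H p)) :
    haveI := D.finiteIndex_H p
    degMap (D.H p) D.G (D.shDelta p χ) = delta (D.corAt p χ) := by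
  have := D.finiteIndex_H p
  have : Algebra.IsAlgebraic k K := IsAlgClosure.isAlgebraic
  exact degMap_eq_delta_cor (D.H_le p) (D.isOpen_H p) χ _ (D.shapiroInv_shDelta p χ)

/-- Each linear factor contributes $-1$, weighted by its exponent. -/
theorem ordAt_zero_sUnits_iota (p : Place D.l) (x : Ind (D.H p) D.G) :
    haveI := D.finiteIndex_H p
    ordAt 0 (D.sUnits (D.iota p x)) = -deg (D.H p) D.G x := by
  have := D.finiteIndex_H p
  have h := D.map_iota ((ordAt 0).comp D.sUnits) p x
  rw [AddMonoidHom.comp_apply] at h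
  rw [h]
  show _ = -(∑ᶠ q : D.G ⧸ (D.H p).subgroupOf D.G, x.1 q.out⁻¹)
  rw [← finsum_neg_distrib]
  refine finsum_congr fun q => ?_
  rw [AddMonoidHom.comp_apply, D.ordAt_zero_sUnits_lin (D.apply_root_ne_zero p _)]
  simp

theorem prU_sStar_iotaMap (p : Place D.l) (χ : Chars (D.H p)) :
    D.prU (D.sStar (D.iotaMap p (D.shDelta p χ))) = -delta (D.σChar (D.corAt p χ)) := by
  have := D.finiteIndex_H p
  rw [delta_σChar, ← degMap_shDelta, prU, sStar, iotaMap, degMap, H2.map_map, H2.map_map,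
    H2.map_map]
  exact H2.map_eq_neg (fun _ => rfl) (D.ordAt_zero_sUnits_iota p) _

/-- Away from $0$, the divisor of $s(\iota(x))$ is supported on the points $c/\sigma(a)$ with
$p(a)=0$, which are the roots of $\tilde p$. -/
theorem prP_sStar_iotaMap_of_ne {p q : Place D.l} (h : D.tilde p ≠ q)
    (y : H2 (indRep (D.H p) D.G)) : D.prP q (D.sStar (D.iotaMap p y)) = 0 := by
  have : IsAlgClosed K := IsAlgClosure.isAlgClosed k
  have hc := D.c_ne_zero'
  rw [prP, sStar, iotaMap, H2.map_map, H2.map_map]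
  refine H2.map_eq_zero (fun x => ?_) _
  ext g
  rw [AddMonoidHom.comp_apply, AddMonoidHom.comp_apply, valAt_apply]
  set b := ((g⁻¹ : D.G) : Gal(K/k)) (D.root q) with hb
  have hb0 : b ≠ 0 := D.apply_root_ne_zero q _
  obtain ⟨b', hb'⟩ := D.σ.surjective (algebraMap k K D.c / b)
  rw [D.ordAt_sUnits hb0 (b' := b') (by rw [hb', mul_div_cancel₀ _ hb0]), ordAt_iota_of_ne]
  · rfl
  · rintro τ rfl
    refine h (D.place_eq_of_root (a := b) ((D.apply_tilde_eq_zero_iff _ _).2 ⟨τ, ?_⟩)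
      (D.aeval_apply_root q _))
    rw [hb', div_div_cancel₀ hc]

/-! ### The component of `s^*` at a fixed point $p=\tilde p$ -/

theorem conj_mem_H {p : Place D.l} {τ : Gal(K/k)}
    (h : (D.σ * τ) (D.root p) = algebraMap k K D.c / D.root p) :
    ∀ g ∈ D.H p, (D.σ * τ)⁻¹ * g * (D.σ * τ) ∈ D.H p := by
  intro g hg
  rw [mem_H]
  refine ⟨D.mem_G.1 (D.conj_mem_G _ _ (D.H_le p hg)), ?_⟩
  -- An element fixing $a_p$ also fixes $c/a_p$, which is the image of $a_p$ under $\sigma\tau$.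
  rw [AlgEquiv.mul_apply, h, AlgEquiv.mul_apply, map_div₀ g, (D.mem_H.1 hg).2, AlgEquiv.commutes,
    ← h, ← AlgEquiv.mul_apply, inv_mul_cancel, AlgEquiv.one_apply]

theorem shapiroInv_prP (p : Place D.l) (z : D.BrRat) :
    shapiroInv (D.H p) D.G (D.H_le p) (D.prP p z) =
      H2.map (Subgroup.inclusion (D.H_le p)) (continuous_subgroup_inclusion _)
        ((evalOne (D.H p) D.G).comp (D.valAt p)) (fun g m =>
          (congrArg (evalOne (D.H p) D.G) (D.valAt_ratRep p _ m)).trans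
            (evalOne_indRep (D.H_le p) g _)) z := by
  rw [shapiroInv_eq_map, prP, H2.map_map]
  exact H2.map_eq_map (fun _ => rfl) (fun _ => rfl) z

theorem sUnits_ratRep (g : D.G) (R : Additive (RatFunc K)ˣ) :
    D.sUnits (D.ratRep (D.conjσ g) R) = D.ratRep g (D.sUnits R) := by
  apply Additive.toMul.injective
  ext
  exact DFunLike.congr_fun (D.s_comp g) (R.toMul : RatFunc K)

theorem sStar_iotaMap (p : Place D.l) (y : H2 (indRep (D.H p) D.G)) :
    D.sStar (D.iotaMap p y) = H2.map D.conjσ D.continuous_conjσ (D.sUnits.comp (D.iota p))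
      (fun g x => (congrArg D.sUnits (D.iota_equivariant p _ x)).trans
        (D.sUnits_ratRep g _)) y := by
  rw [sStar, iotaMap, H2.map_map]
  exact H2.map_eq_map (fun _ => rfl) (fun _ => rfl) y

theorem conj_shapiroInv {p : Place D.l} {γ : Gal(K/k)}
    (h : ∀ g ∈ D.H p, γ⁻¹ * g * γ ∈ D.H p) (y : H2 (indRep (D.H p) D.G)) :
      H2.map (conjHom γ (D.H p) (D.H p) h) (continuous_conjHom _ _ _ _)
        (AddMonoidHom.id ℤ) (ρ' := 1) (fun _ _ => rfl) (shapiroInv (D.H p) D.G (D.H_le p) y) =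
      H2.map ((Subgroup.inclusion (D.H_le p)).comp (conjHom γ (D.H p) (D.H p) h))
        ((continuous_subgroup_inclusion (D.H_le p)).comp (continuous_conjHom γ _ _ h))
        (evalOne (D.H p) D.G) (ρ' := 1)
        (fun g m => evalOne_indRep (D.H_le p) (conjHom γ (D.H p) (D.H p) h g) m) y := by
  rw [shapiroInv_eq_map, H2.map_map]
  rfl

/-- The hypothesis reads $a_p\,\sigma(t\,a_p)=c$, so the order of $s(\iota(x))$ at $a_p$ is the
order of $\iota(x)$ at $t(a_p)$. -/
theorem ordAt_sUnits_iota {p : Place D.l} (t : D.G)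
    (h : (D.σ * t) (D.root p) = algebraMap k K D.c / D.root p) (x : Ind (D.H p) D.G) :
    ordAt (D.root p) (D.sUnits (D.iota p x)) = x.1 t⁻¹ := by
  have : IsAlgClosed K := IsAlgClosure.isAlgClosed k
  rw [← ordAt_iota_root]
  refine D.ordAt_sUnits (D.root_ne_zero p) ?_ _
  rw [← AlgEquiv.mul_apply, h, mul_div_cancel₀ _ (D.root_ne_zero p)]

/-- The action of `t⁻¹` on the induced module. -/
def indShift (p : Place D.l) (t : D.G) : Ind (D.H p) D.G →+ Ind (D.H p) D.G :=
  indRep (D.H p) D.G t⁻¹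

theorem evalOne_indShift (p : Place D.l) (t : D.G) (x : Ind (D.H p) D.G) :
    evalOne (D.H p) D.G (D.indShift p t x) = x.1 t⁻¹ :=
  congrArg x.1 (one_mul t⁻¹)

theorem indShift_conj (p : Place D.l) (t g : D.G) (x : Ind (D.H p) D.G) :
    D.indShift p t (indRep (D.H p) D.G ((MulAut.conj t).toMonoidHom g) x) =
      indRep (D.H p) D.G g (D.indShift p t x) := by
  show (indRep (D.H p) D.G t⁻¹ * indRep (D.H p) D.G (t * g * t⁻¹)) x =
    (indRep (D.H p) D.G g * indRep (D.H p) D.G t⁻¹) x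
  rw [← map_mul, ← map_mul, mul_assoc, inv_mul_cancel_left]

theorem continuous_mulAutConj (t : D.G) : Continuous (MulAut.conj t).toMonoidHom := by
  show Continuous fun g => t * g * t⁻¹
  fun_prop

theorem map_indShift (p : Place D.l) (t : D.G) (y : H2 (indRep (D.H p) D.G)) :
    H2.map (MulAut.conj t).toMonoidHom (D.continuous_mulAutConj t) (D.indShift p t)
      (D.indShift_conj p t) y = y :=
  H2.map_inner t⁻¹ (fun g => by simp) (fun _ => rfl) y

theorem evalOne_valAt (p : Place D.l) (R : Additive (RatFunc K)ˣ) :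
    evalOne (D.H p) D.G (D.valAt p R) = ordAt (D.root p) R := by
  show (D.valAt p R).1 1 = _
  rw [valAt_apply, inv_one]
  rfl

/-- The left side is induced by conjugation by $\sigma$ on $H$ and $x\mapsto x(t^{-1})$; the right
side by conjugation by $\sigma t$ and $x\mapsto x(1)$. Inserting the inner pair given by $t$, which
acts as the identity on $H^2(G_l,A)$, makes the two pairs equal. -/
theorem shapiroInv_prP_sStar_iotaMap {p : Place D.l} (t : D.G)
    (h : (D.σ * t) (D.root p) = algebraMap k K D.c / D.root p) (y : H2 (indRep (D.H p) D.G)) :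
    shapiroInv (D.H p) D.G (D.H_le p) (D.prP p (D.sStar (D.iotaMap p y))) =
      H2.map (conjHom (D.σ * t) (D.H p) (D.H p) (D.conj_mem_H h)) (continuous_conjHom _ _ _ _)
        (AddMonoidHom.id ℤ) (ρ' := 1) (fun _ _ => rfl)
        (shapiroInv (D.H p) D.G (D.H_le p) y) := by
  conv_rhs => rw [← D.map_indShift p t y]
  rw [shapiroInv_prP, sStar_iotaMap, conj_shapiroInv, H2.map_map, H2.map_map]
  exact H2.map_eq_map (conjHom_inclusion D.σ (D.H_le p) t (D.conj_mem_G D.σ) (D.conj_mem_H h))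
    (fun x => by
      rw [AddMonoidHom.comp_apply, AddMonoidHom.comp_apply, AddMonoidHom.comp_apply,
        AddMonoidHom.comp_apply, evalOne_valAt, evalOne_indShift, D.ordAt_sUnits_iota t h]) y

theorem prP_sStar_iotaMap_self {p : Place D.l} {τ : Gal(K/k)} (hτ : τ ∈ D.G)
    (h : (D.σ * τ) (D.root p) = algebraMap k K D.c / D.root p) (χ : Chars (D.H p)) :
    D.prP p (D.sStar (D.iotaMap p (D.shDelta p χ))) =
      D.shDelta p (conjChar (D.σ * τ) (D.H p) (D.H p) (D.conj_mem_H h) χ) := by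
  apply (D.shapiroInv_bij p).1
  rw [shapiroInv_shDelta, D.shapiroInv_prP_sStar_iotaMap ⟨τ, hτ⟩ h, shapiroInv_shDelta]
  exact (delta_comp _ _ χ _ fun _ => rfl).symm

/-! ### The matrix of `s^*` in the decomposition, and the three assertions -/

variable {D} {e : D.Dec ≃+ D.BrRat}

theorem IsABF.abfHom_sDec (he : D.IsABF e) (x : D.Dec) :
    D.abfHom (D.sDec e x) = D.sStar (D.abfHom x) := by
  rw [← he.apply_eq, ← he.apply_eq]
  exact e.apply_symm_apply _

theorem IsABF.sDec_sDec (he : D.IsABF e) (x : D.Dec) : D.sDec e (D.sDec e x) = x := by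
  apply D.abfHom_bijective.1
  rw [he.abfHom_sDec, he.abfHom_sDec, sStar_sStar]

theorem IsABF.sDec_const (he : D.IsABF e) (β : D.Br) : D.sDec e (β, 0, 0) = (D.σBr β, 0, 0) := by
  apply D.abfHom_bijective.1
  rw [he.abfHom_sDec, abfHom_const, abfHom_const, sStar_constMap]

theorem corSum_inclAt (p : Place D.l) (χ : Chars (D.H p)) :
    D.corSum (D.inclAt p χ).2.2 = D.corAt p χ := by
  simp [corSum, inclAt]

theorem IsABF.sDec_u (he : D.IsABF e) (x : D.Dec) :
    (D.sDec e x).2.1 = -D.σChar x.2.1 - D.σChar (D.corSum x.2.2) := by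
  apply D.delta_bij.1
  rw [← prU_abfHom, he.abfHom_sDec]
  induction x using D.dec_induction with
  | h₁ β => rw [abfHom_const, sStar_constMap, prU_constMap]; simp
  | h₂ χ => rw [abfHom_u, prU_sStar_piMap]; simp
  | h₃ p χ =>
    have h0 : (D.inclAt p χ).2.1 = 0 := rfl
    rw [abfHom_inclAt, prU_sStar_iotaMap, corSum_inclAt, h0]
    simp
  | hadd x y hx hy =>
    rw [map_add, map_add, map_add, hx, hy, ← map_add]
    congr 1
    simp only [Prod.snd_add, Prod.fst_add, map_add]
    abel

theorem IsABF.sDec_const_p (he : D.IsABF e) (β : D.Br) (χ : Chars D.G) (q : Place D.l) :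
    (D.sDec e (β, χ, 0)).2.2 q = 0 := by
  apply (D.shDelta q).injective
  have : ((β, χ, 0) : D.Dec) = (β, 0, 0) + (0, χ, 0) := by simp
  rw [← prP_abfHom, he.abfHom_sDec, this, map_add, abfHom_const, abfHom_u, map_add, map_add,
    prP_sStar_piMap, sStar_constMap, prP_constMap, map_zero, add_zero]

theorem IsABF.sDec_inclAt_of_ne (he : D.IsABF e) {p q : Place D.l} (h : D.tilde p ≠ q)
    (χ : Chars (D.H p)) : (D.sDec e (D.inclAt p χ)).2.2 q = 0 := by
  apply (D.shDelta q).injective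
  rw [← prP_abfHom, he.abfHom_sDec, abfHom_inclAt, D.prP_sStar_iotaMap_of_ne h, map_zero]

/-- The component of `s^*` at `p̃` depends only on the component at `p`. -/
theorem IsABF.sDec_tilde (he : D.IsABF e) (x : D.Dec) (p : Place D.l) :
    (D.sDec e x).2.2 (D.tilde p) = D.sPQ e p (D.tilde p) (x.2.2 p) := by
  induction x using D.dec_induction with
  | h₁ β => rw [he.sDec_const_p]; exact (map_zero _).symm
  | h₂ χ => rw [he.sDec_const_p]; exact (map_zero _).symm
  | h₃ q χ =>
    by_cases h : q = p
    · obtain rfl := h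
      rw [inclAt_self]
      rfl
    · rw [D.inclAt_of_ne h, map_zero, he.sDec_inclAt_of_ne]
      intro h'
      exact h (by rw [← D.tilde_tilde q, h', D.tilde_tilde])
  | hadd x y hx hy =>
    have h1 : (x + y).2.2 p = x.2.2 p + y.2.2 p := rfl
    rw [map_add, h1, map_add, ← hx, ← hy]
    rfl

theorem sDec_fst (χu : Chars D.G) (χ : DirectSum (Place D.l) fun p => Chars (D.H p)) :
    (D.sDec e (0, χu, χ)).1 = D.s1 e (χu, χ) := by
  classical
  have h1 : ((0, χu, χ) : D.Dec) = (0, χu, 0) + (0, 0, χ) := by simp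
  have h2 : (D.sDec e (0, 0, χ)).1 = DirectSum.toAddMonoid (D.sP1 e) χ := by
    induction χ using DirectSum.induction_on with
    | zero => rw [map_zero]; exact congrArg Prod.fst (map_zero (D.sDec e))
    | of p χ =>
      rw [DirectSum.toAddMonoid_of, sP1]
      congr! 2
    | add χ χ' h h' =>
      have h3 : ((0, 0, χ + χ') : D.Dec) = (0, 0, χ) + (0, 0, χ') := by simp
      rw [h3, map_add, map_add, ← h (by simp), ← h' (by simp)]
      rfl
  rw [h1, map_add, Prod.fst_add, h2, s1, AddMonoidHom.coprod_apply]
  congr! 1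

/-- The $u$-component of $s^*s^*\chi_p=\chi_p$ is
$\mathrm{Cor}\,\chi_p-\sigma\,\mathrm{Cor}(s^*_{p\tilde p}\chi_p)=0$; apply $\sigma$. -/
theorem IsABF.corAt_sPQ (he : D.IsABF e) (p : Place D.l) (χ : Chars (D.H p)) :
    D.corAt (D.tilde p) (D.sPQ e p (D.tilde p) χ) = D.σChar (D.corAt p χ) := by
  have h := he.sDec_u (D.sDec e (D.inclAt p χ))
  have h1 : (D.sDec e (D.inclAt p χ)).2.2 =
      (D.inclAt (D.tilde p) (D.sPQ e p (D.tilde p) χ)).2.2 := by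
    refine DFinsupp.ext fun q => ?_
    by_cases hq : D.tilde p = q
    · obtain rfl := hq
      exact (D.inclAt_self _ _).symm
    · exact (he.sDec_inclAt_of_ne hq χ).trans (D.inclAt_of_ne hq _).symm
  have h0 : (D.inclAt p χ).2.1 = 0 := rfl
  rw [he.sDec_sDec, h1, he.sDec_u, corSum_inclAt, corSum_inclAt, h0, map_zero, neg_zero, zero_sub,
    map_neg, neg_neg, ← map_sub] at h
  have h2 := congrArg D.σChar h
  rw [σChar_σChar, map_zero, eq_comm, sub_eq_zero] at h2
  exact h2.symm

theorem exists_conj_of_tilde_eq {p : Place D.l} (hp : D.tilde p = p) :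
    ∃ τ ∈ D.G, (D.σ * τ) (D.root p) = algebraMap k K D.c / D.root p := by
  obtain ⟨τ, hτ⟩ := (D.apply_tilde_eq_zero_iff p (D.root p)).1 (by rw [hp, D.aeval_root])
  refine ⟨τ, τ.2, ?_⟩
  rw [AlgEquiv.mul_apply, ← div_div_cancel₀ D.c_ne_zero' (b := D.σ _), hτ]

theorem IsABF.sPQ_self (he : D.IsABF e) {p : Place D.l} {τ : Gal(K/k)} (hτ : τ ∈ D.G)
    (h : (D.σ * τ) (D.root p) = algebraMap k K D.c / D.root p) (χ : Chars (D.H p)) :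
    D.sPQ e p p χ = conjChar (D.σ * τ) (D.H p) (D.H p) (D.conj_mem_H h) χ := by
  apply (D.shDelta p).injective
  rw [← D.prP_sStar_iotaMap_self hτ h, ← abfHom_inclAt, ← he.abfHom_sDec, prP_abfHom]
  rfl

theorem IsABF.sDec_snd_snd (he : D.IsABF e) {χ : DirectSum (Place D.l) fun p => Chars (D.H p)}
    (h : ∀ p, D.sPQ e p (D.tilde p) (χ p) = χ (D.tilde p)) (χu : Chars D.G) :
    (D.sDec e (0, χu, χ)).2.2 = χ := by
  refine DFinsupp.ext fun q => ?_
  rw [← D.tilde_tilde q]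
  exact (he.sDec_tilde _ _).trans (h _)

/-- By hypothesis $s^*$ preserves the tuple $\chi$, so the $u$-component of $s^*s^*(0,0,\chi)$ is
$\mathrm{Cor}\,\chi-\sigma\,\mathrm{Cor}\,\chi$, and it must vanish. -/
theorem IsABF.σChar_corSum (he : D.IsABF e) {χ : DirectSum (Place D.l) fun p => Chars (D.H p)}
    (h : ∀ p, D.sPQ e p (D.tilde p) (χ p) = χ (D.tilde p)) :
    D.σChar (D.corSum χ) = D.corSum χ := by
  have h1 := he.sDec_u (D.sDec e (0, 0, χ))
  rw [he.sDec_sDec, he.sDec_u, he.sDec_snd_snd h, map_zero, neg_zero, zero_sub, map_neg, neg_neg,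
    σChar_σChar, eq_comm, sub_eq_zero] at h1
  exact h1.symm

theorem IsABF.σBr_s1 (he : D.IsABF e) {χ : DirectSum (Place D.l) fun p => Chars (D.H p)}
    (h : ∀ p, D.sPQ e p (D.tilde p) (χ p) = χ (D.tilde p)) {χu : Chars D.G}
    (hu : χu + D.σChar χu = -D.corSum χ) : D.σBr (D.s1 e (χu, χ)) = -D.s1 e (χu, χ) := by
  -- The $u$-component is
  -- $-\sigma\chi_u-\sigma\,\mathrm{Cor}\,\chi=-\sigma\chi_u-\mathrm{Cor}\,\chi$, which equals
  -- $\chi_u$ by `hu`. Thus $s^*$ changes only the constant part.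
  have h1 : D.sDec e (0, χu, χ) = (D.s1 e (χu, χ), 0, 0) + (0, χu, χ) := by
    refine Prod.ext ?_ (Prod.ext ?_ ?_)
    · simpa using D.sDec_fst χu χ
    · rw [he.sDec_u, he.σChar_corSum h]
      simp only [Prod.snd_add, Prod.fst_add, zero_add]
      rw [sub_eq_add_neg, ← hu]
      abel
    · rw [he.sDec_snd_snd h]
      simp
  have h2 := he.sDec_sDec (0, χu, χ)
  rw [h1, map_add, he.sDec_const, h1] at h2
  have h3 := congrArg Prod.fst h2
  simp only [Prod.fst_add, add_zero] at h3
  exact eq_neg_of_add_eq_zero_left h3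

end Datum

end

end GenusZero

theorem mainTheorem6 {k K : Type*} [Field k] [PerfectField k] [Field K] [Algebra k K]
    [IsAlgClosure k K] (D : GenusZero.Datum k K) :
    (∃! e : D.Dec ≃+ D.BrRat, D.IsABF e) ∧
    ∀ e : D.Dec ≃+ D.BrRat, D.IsABF e →
      (∀ (p : GenusZero.Place D.l) (χ : GenusZero.Chars (D.H p)),
        D.corAt (D.tilde p) (D.sPQ e p (D.tilde p) χ) = D.σChar (D.corAt p χ)) ∧
      (∀ p : GenusZero.Place D.l, D.tilde p = p →
        (∃ τ ∈ D.G, (D.σ * τ) (D.root p) = algebraMap k K D.c / D.root p) ∧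
        ∀ τ ∈ D.G, (D.σ * τ) (D.root p) = algebraMap k K D.c / D.root p →
          ∃ hτ : ∀ g ∈ D.H p, (D.σ * τ)⁻¹ * g * (D.σ * τ) ∈ D.H p,
            ∀ χ : GenusZero.Chars (D.H p),
              D.sPQ e p p χ = GenusZero.conjChar (D.σ * τ) (D.H p) (D.H p) hτ χ) ∧
      (∀ χ : DirectSum (GenusZero.Place D.l) fun p => GenusZero.Chars (D.H p),
        (∀ p, D.sPQ e p (D.tilde p) (χ p) = χ (D.tilde p)) →
          D.σChar (D.corSum χ) = D.corSum χ ∧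
          ∀ χu : GenusZero.Chars D.G, χu + D.σChar χu = -D.corSum χ →
            D.σBr (D.s1 e (χu, χ)) = -D.s1 e (χu, χ)) :=
  ⟨D.existsUnique_isABF, fun _ he => ⟨he.corAt_sPQ, fun _ hp =>
    ⟨D.exists_conj_of_tilde_eq hp, fun _ hτ h => ⟨D.conj_mem_H h, he.sPQ_self hτ h⟩⟩,
    fun _ h => ⟨he.σChar_corSum h, fun _ hu => he.σBr_s1 h hu⟩⟩⟩
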